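/- For $x\in[-1,1]$ let \[ h(x) = x\int_0^{\pi/2}\frac{\cos^2 t}{\sqrt{1-x^2\sin^2 t}}\,dt \] be the real Haagerup function, that is, the restriction to $[-1,1]$ of the complex Haagerup function $H(z)=z\int_0^{\pi/2}\cos^2 t\,(1-|z|^2\sin^2 t)^{-1/2}\,dt$, $|z|\le 1$. Then $h$ is a bijection of $[-1,1]$ onto itself, and its inverse $h^{-1}:[-1,1]\to[-1,1]$ has a power series expansion with real coefficients \[ h^{-1}(x)=\sum_{k=0}^{\infty} b_{2k+1}x^{2k+1} \] valid in some neighborhood of $0$. For every such expansion, $b_{2k+1}\le 0$ for all integers $k\ge 1$. -/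

import Mathlib

/-!
Put `g z = h (sin z)`, which extends holomorphically from `(0, π/2)` to the strip `|Re z| < π/2`, is
continuous up to the boundary, real on the real axis and imaginary on the imaginary axis. If
`h⁻¹ y = ∑ b_{2k+1} y^{2k+1}`, then `sin z = ∑ b_{2k+1} (g z)^{2k+1}` near `0`. Integrating
`cos z * (g z)^{-(2k+1)}` along the boundary of the rectangle `[0, π/2] × [0, 4]`, with the pole at
the corner `0` cut off, gives `(2k+1) b_{2k+1} π/2` as the imaginary part of the integral over the
right edge minus that over the top edge.

On the right edge, `y ↦ g (π/2 + iy)` is expressed by complete elliptic integrals, and by Legendre's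
relation the imaginary part of its derivative times its conjugate is `(π/2) tanh y`, so that its
argument increases. Integrating the oscillating factor `sin ((2k+1) arg g)` by parts shows that this
edge contributes at most `-45 / 3^{2k+1}` for `k ≥ 10`, which outweighs the top edge, where
`|g| ≥ 3`. For `k < 10` the numbers `b_{2k+1} π^{2k+1} / 4` are integers determined by a triangular
linear system, since `h (4√w) / (π√w) = ∑ C_j binom(2j, j) w^j` with the Catalan numbers `C_j`.
-/

open Set Filter Topology

/-- The complex Haagerup function
`H z = z * ∫ t in 0..π/2, cos² t / √(1 - |z|² sin² t)`; it is used for `|z| ≤ 1` only. -/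
noncomputable def complexHaagerup (z : ℂ) : ℂ :=
  z * ((∫ t in (0 : ℝ)..(Real.pi / 2),
    Real.cos t ^ 2 / Real.sqrt (1 - ‖z‖ ^ 2 * Real.sin t ^ 2) : ℝ) : ℂ)

/-- The real Haagerup function
`h x = x * ∫ t in 0..π/2, cos² t / √(1 - x² sin² t)`; it is used for `x ∈ [-1, 1]` only. -/
noncomputable def realHaagerup (x : ℝ) : ℝ :=
  x * ∫ t in (0 : ℝ)..(Real.pi / 2),
    Real.cos t ^ 2 / Real.sqrt (1 - x ^ 2 * Real.sin t ^ 2)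

/-- The real Haagerup function is the restriction of the complex one to the reals. -/
theorem ofReal_realHaagerup (x : ℝ) :
    ((realHaagerup x : ℝ) : ℂ) = complexHaagerup (x : ℂ) := by
  simp [realHaagerup, complexHaagerup]

/-- The inverse `h⁻¹ : [-1, 1] → [-1, 1]` of the real Haagerup function; for `y ∈ [-1, 1]` it is the
point `x ∈ [-1, 1]` with `h x = y` (its values for `y ∉ [-1, 1]` are irrelevant). -/
noncomputable def realHaagerupInv (y : ℝ) : ℝ :=
  Function.invFunOn realHaagerup (Icc (-1) 1) y

/-- `∑ b_{2k+1} x^{2k+1}`, where `b k` stands for the coefficient `b_{2k+1}`, is the power series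
expansion of `h⁻¹` in some neighborhood of `0`. -/
def IsHaagerupInvExpansion (b : ℕ → ℝ) : Prop :=
  ∀ᶠ x in 𝓝 (0 : ℝ), HasSum (fun k : ℕ => b k * x ^ (2 * k + 1)) (realHaagerupInv x)

open Complex (I)
open scoped Real

theorem ae_mem_uIoc_imp_mem_Ioo {a b : ℝ} (hab : a ≤ b) :
    ∀ᵐ t : ℝ, t ∈ uIoc a b → t ∈ Ioo a b := by
  rw [uIoc_of_le hab]
  filter_upwards [MeasureTheory.Measure.ae_ne MeasureTheory.volume b] with t ht hmem
  exact ⟨hmem.1, hmem.2.lt_of_ne ht⟩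

theorem norm_deriv_le_of_differentiableOn_ball {f : ℂ → ℂ} {z : ℂ} {ε C : ℝ} (hε : 0 < ε)
    (hf : DifferentiableOn ℂ f (Metric.ball z ε))
    (hC : ∀ w ∈ Metric.ball z ε, ‖f w‖ ≤ C) {w : ℂ} (hw : w ∈ Metric.ball z (ε / 2)) :
    ‖deriv f w‖ ≤ C / (ε / 2) := by
  have hsub : Metric.closedBall w (ε / 2) ⊆ Metric.ball z ε :=
    Metric.closedBall_subset_ball' (by rw [Metric.mem_ball] at hw; linarith)
  refine Complex.norm_deriv_le_of_forall_mem_sphere_norm_le (half_pos hε)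
    (DifferentiableOn.diffContOnCl ?_) fun v hv => hC v (hsub (Metric.sphere_subset_closedBall hv))
  rw [closure_ball _ (half_pos hε).ne']
  exact hf.mono hsub

theorem differentiableAt_intervalIntegral_of_norm_le {F : ℂ → ℝ → ℂ} {a b C : ℝ} {U : Set ℂ}
    {z : ℂ} (hU : U ∈ 𝓝 z)
    (hmeas : ∀ w ∈ U, MeasureTheory.AEStronglyMeasurable (F w)
      (MeasureTheory.volume.restrict (uIoc a b)))
    (hdiff : ∀ᵐ t : ℝ, t ∈ uIoc a b → DifferentiableOn ℂ (fun w => F w t) U)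
    (hC : ∀ᵐ t : ℝ, t ∈ uIoc a b → ∀ w ∈ U, ‖F w t‖ ≤ C) :
    DifferentiableAt ℂ (fun w => ∫ t in a..b, F w t) z := by
  obtain ⟨ε, hε, hball⟩ := Metric.mem_nhds_iff.1 hU
  have hz : z ∈ U := mem_of_mem_nhds hU
  have hderiv : ∀ᵐ t : ℝ, t ∈ uIoc a b → ∀ w ∈ Metric.ball z (ε / 2),
      HasDerivAt (fun w => F w t) (deriv (fun w => F w t) w) w := by
    filter_upwards [hdiff] with t ht hmem w hw
    exact ((ht hmem).differentiableAt (mem_of_superset (Metric.isOpen_ball.mem_nhds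
      (Metric.ball_subset_ball (half_le_self hε.le) hw)) hball)).hasDerivAt
  have hmeas_deriv : MeasureTheory.AEStronglyMeasurable (fun t => deriv (fun w => F w t) z)
      (MeasureTheory.volume.restrict (uIoc a b)) := by
    obtain ⟨c, hcU, hc⟩ : ∃ c : ℕ → ℂ, (∀ n, c n ∈ U) ∧ Tendsto c atTop (𝓝[≠] z) := by
      obtain ⟨c, hc⟩ := exists_seq_tendsto (𝓝[≠] z)
      obtain ⟨N, hN⟩ := eventually_atTop.1 (hc.eventually (mem_nhdsWithin_of_mem_nhds hU))
      exact ⟨fun n => c (n + N), fun n => hN _ (Nat.le_add_left _ _),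
        hc.comp (tendsto_add_atTop_nat N)⟩
    refine aestronglyMeasurable_of_tendsto_ae atTop
      (f := fun n t => slope (fun w => F w t) z (c n))
      (fun n => ((hmeas _ (hcU n)).sub (hmeas z hz)).const_smul _) ?_
    refine (MeasureTheory.ae_restrict_iff' measurableSet_uIoc).2 ?_
    filter_upwards [hderiv] with t ht hmem
    exact (ht hmem z (Metric.mem_ball_self (half_pos hε))).tendsto_slope.comp hc
  refine (intervalIntegral.hasDerivAt_integral_of_dominated_loc_of_deriv_le
    (F' := fun w t => deriv (fun w => F w t) w) (bound := fun _ => C / (ε / 2))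
    (Metric.ball_mem_nhds z (half_pos hε)) (mem_of_superset hU hmeas) ?_ hmeas_deriv ?_
    intervalIntegrable_const hderiv).2.differentiableAt
  · refine intervalIntegrable_const.mono_fun' (hmeas z hz) (g := fun _ => C) ?_
    refine (MeasureTheory.ae_restrict_iff' measurableSet_uIoc).2 ?_
    filter_upwards [hC] with t ht hmem using ht hmem z hz
  · filter_upwards [hdiff, hC] with t hd hb hmem w hw
    exact norm_deriv_le_of_differentiableOn_ball hε ((hd hmem).mono hball)
      (fun v hv => hb hmem v (hball hv)) hw

section StripSine

variable {z : ℂ} {r : ℝ}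

theorem sq_norm_complex_sin (z : ℂ) :
    ‖Complex.sin z‖ ^ 2 = (Real.cosh (2 * z.im) - Real.cos (2 * z.re)) / 2 := by
  have hsin : Complex.sin z = ((Real.sin z.re * Real.cosh z.im : ℝ) : ℂ)
      + ((Real.cos z.re * Real.sinh z.im : ℝ) : ℂ) * I := by
    rw [Complex.sin_eq z]; push_cast; ring
  rw [hsin, ← Complex.normSq_eq_norm_sq, Complex.normSq_add_mul_I, Real.cosh_two_mul,
    Real.cos_two_mul, mul_pow, mul_pow, Real.cosh_sq, Real.sin_sq]
  ring

theorem norm_sin_mul_lt (hz : |z.re| ≤ π / 2) (hz0 : z ≠ 0) (hr : r ∈ Ico 0 1) :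
    ‖Complex.sin (r * z)‖ < ‖Complex.sin z‖ := by
  have habs (x : ℝ) : |2 * (r * x)| = r * |2 * x| := by
    rw [mul_left_comm, abs_mul, abs_of_nonneg hr.1]
  have hle (x : ℝ) : |2 * (r * x)| ≤ |2 * x| :=
    (habs x).trans_le (mul_le_of_le_one_left (abs_nonneg _) hr.2.le)
  have hlt {x : ℝ} (hx : x ≠ 0) : |2 * (r * x)| < |2 * x| :=
    (habs x).trans_lt (mul_lt_of_lt_one_left (by positivity) hr.2)
  have hpi : |2 * z.re| ≤ π := by rw [abs_mul, abs_two]; linarith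
  have hcosh : Real.cosh (2 * (r * z.im)) ≤ Real.cosh (2 * z.im) := Real.cosh_le_cosh.2 (hle _)
  have hcos : Real.cos (2 * z.re) ≤ Real.cos (2 * (r * z.re)) := by
    rw [← Real.cos_abs, ← Real.cos_abs (2 * (r * z.re))]
    exact Real.cos_le_cos_of_nonneg_of_le_pi (abs_nonneg _) hpi (hle _)
  refine lt_of_pow_lt_pow_left₀ 2 (norm_nonneg _) ?_
  rw [sq_norm_complex_sin, sq_norm_complex_sin, Complex.re_ofReal_mul, Complex.im_ofReal_mul]
  rcases eq_or_ne z.re 0 with hre | hre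
  · have hcosh' := Real.cosh_lt_cosh.2 (hlt fun him => hz0 (Complex.ext hre him))
    linarith
  · have hcos' : Real.cos (2 * z.re) < Real.cos (2 * (r * z.re)) := by
      rw [← Real.cos_abs, ← Real.cos_abs (2 * (r * z.re))]
      exact Real.cos_lt_cos_of_nonneg_of_le_pi (abs_nonneg _) hpi (hlt hre)
    linarith

theorem complex_sin_ne_zero_of_abs_re_le (hz : |z.re| ≤ π / 2) (hz0 : z ≠ 0) :
    Complex.sin z ≠ 0 :=
  norm_pos_iff.1 ((norm_nonneg _).trans_lt (norm_sin_mul_lt hz hz0 ⟨le_rfl, zero_lt_one⟩))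

theorem norm_sin_mul_div_sin_lt_one (hz : |z.re| ≤ π / 2) (hz0 : z ≠ 0) (hr : r ∈ Ico 0 1) :
    ‖Complex.sin (r * z) / Complex.sin z‖ < 1 := by
  rw [norm_div, div_lt_one (norm_pos_iff.2 (complex_sin_ne_zero_of_abs_re_le hz hz0))]
  exact norm_sin_mul_lt hz hz0 hr

theorem norm_complex_sin_le_cosh_im (z : ℂ) : ‖Complex.sin z‖ ≤ Real.cosh z.im := by
  refine le_of_sq_le_sq ?_ (Real.cosh_pos _).le
  rw [sq_norm_complex_sin, Real.cosh_two_mul, Real.sinh_sq]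
  linarith [Real.neg_one_le_cos (2 * z.re)]

end StripSine

section ComplexSqrt

variable {q w : ℂ}

theorem sq_complex_sqrt (w : ℂ) : Complex.sqrt w ^ 2 = w := by
  simp [Complex.sqrt]

theorem norm_complex_sqrt (w : ℂ) : ‖Complex.sqrt w‖ = √‖w‖ := by
  rw [eq_comm, Real.sqrt_eq_iff_eq_sq (norm_nonneg _) (norm_nonneg _), ← norm_pow,
    sq_complex_sqrt]

theorem re_complex_sqrt_nonneg (w : ℂ) : 0 ≤ (Complex.sqrt w).re :=
  (Real.sqrt_nonneg _).trans_eq (Complex.cpow_inv_two_re w).symm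

theorem re_complex_sqrt_pos (hw : 0 < w.re) : 0 < (Complex.sqrt w).re := by
  rw [Complex.sqrt, Complex.cpow_inv_two_re, Real.sqrt_pos]
  linarith [norm_nonneg w]

theorem ofReal_sqrt {x : ℝ} (hx : 0 ≤ x) : ((√x : ℝ) : ℂ) = Complex.sqrt x :=
  (Complex.sqrt_of_nonneg (Complex.zero_le_real.2 hx)).symm

theorem re_one_sub_sq_pos (hq : ‖q‖ < 1) : 0 < (1 - q ^ 2).re := by
  have hre : (q ^ 2).re < 1 := calc
    (q ^ 2).re ≤ ‖q ^ 2‖ := Complex.re_le_norm _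
    _ = ‖q‖ ^ 2 := norm_pow _ _
    _ < 1 := pow_lt_one₀ (norm_nonneg _) hq two_ne_zero
  simpa using hre

theorem norm_sqrt_one_sub_sq_le (hq : ‖q‖ ≤ 1) : ‖Complex.sqrt (1 - q ^ 2)‖ ≤ 2 := by
  rw [norm_complex_sqrt, Real.sqrt_le_iff]
  refine ⟨zero_le_two, (norm_sub_le _ _).trans ?_⟩
  rw [norm_pow, norm_one]
  linarith [pow_le_one₀ (n := 2) (norm_nonneg _) hq]

theorem norm_one_sub_sqrt_one_sub_le (q : ℂ) : ‖1 - Complex.sqrt (1 - q)‖ ≤ ‖q‖ := by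
  have hfactor : q = (1 - Complex.sqrt (1 - q)) * (1 + Complex.sqrt (1 - q)) := by
    linear_combination sq_complex_sqrt (1 - q)
  have hone_le : 1 ≤ ‖1 + Complex.sqrt (1 - q)‖ := by
    refine le_trans ?_ (Complex.re_le_norm _)
    simpa using re_complex_sqrt_nonneg (1 - q)
  conv_rhs => rw [hfactor, norm_mul]
  exact le_mul_of_one_le_right (norm_nonneg _) hone_le

end ComplexSqrt

/-- The integrand of `haagerupLiftFactor`, obtained by substituting `x = sin z` and `s = r * z` in
`h x = ∫ s in 0..arcsin x, √(1 - sin² s / x²)`. -/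
noncomputable def haagerupLiftIntegrand (z : ℂ) (r : ℝ) : ℂ :=
  Complex.sqrt (1 - (Complex.sin (r * z) / Complex.sin z) ^ 2)

/-- The quotient `h (sin z) / z`, continued analytically from the segment `(0, π/2)`. -/
noncomputable def haagerupLiftFactor (z : ℂ) : ℂ :=
  ∫ r in (0 : ℝ)..1, haagerupLiftIntegrand z r

/-- The lift `z ↦ h (sin z)` of the Haagerup function, continued analytically from the
segment `(0, π/2)` to the strip `|Re z| ≤ π/2`. -/
noncomputable def haagerupLift (z : ℂ) : ℂ :=
  z * haagerupLiftFactor z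

section Lift

variable {z : ℂ} {r : ℝ}

theorem one_sub_sq_sin_mul_div_sin_mem_slitPlane (hz : |z.re| ≤ π / 2) (hz0 : z ≠ 0)
    (hr : r ∈ Ico 0 1) :
    1 - (Complex.sin (r * z) / Complex.sin z) ^ 2 ∈ Complex.slitPlane :=
  Or.inl (re_one_sub_sq_pos (norm_sin_mul_div_sin_lt_one hz hz0 hr))

theorem norm_haagerupLiftIntegrand_le (hz : |z.re| ≤ π / 2) (hr : r ∈ Ico 0 1) :
    ‖haagerupLiftIntegrand z r‖ ≤ 2 := by
  refine norm_sqrt_one_sub_sq_le ?_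
  rcases eq_or_ne z 0 with rfl | hz0
  · simp
  · exact (norm_sin_mul_div_sin_lt_one hz hz0 hr).le

theorem ae_norm_haagerupLiftIntegrand_le (hz : |z.re| ≤ π / 2) :
    ∀ᵐ r : ℝ, r ∈ uIoc 0 1 → ‖haagerupLiftIntegrand z r‖ ≤ 2 := by
  filter_upwards [ae_mem_uIoc_imp_mem_Ioo zero_le_one] with r hr hmem
  exact norm_haagerupLiftIntegrand_le hz (Ioo_subset_Ico_self (hr hmem))

theorem differentiableAt_haagerupLiftIntegrand (hz : |z.re| ≤ π / 2) (hz0 : z ≠ 0)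
    (hr : r ∈ Ico 0 1) : DifferentiableAt ℂ (fun z => haagerupLiftIntegrand z r) z := by
  have hsin := complex_sin_ne_zero_of_abs_re_le hz hz0
  refine (Complex.differentiableAt_sqrt
    (one_sub_sq_sin_mul_div_sin_mem_slitPlane hz hz0 hr)).comp z ?_
  fun_prop (disch := assumption)

theorem aestronglyMeasurable_haagerupLiftIntegrand (z : ℂ) (μ : MeasureTheory.Measure ℝ) :
    MeasureTheory.AEStronglyMeasurable (haagerupLiftIntegrand z) μ := by
  have hcont : Continuous fun r : ℝ => 1 - (Complex.sin (r * z) / Complex.sin z) ^ 2 := by fun_prop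
  exact (hcont.measurable.pow_const _).aestronglyMeasurable

theorem intervalIntegrable_haagerupLiftIntegrand (hz : |z.re| ≤ π / 2) :
    IntervalIntegrable (haagerupLiftIntegrand z) MeasureTheory.volume 0 1 :=
  (intervalIntegrable_const (c := (2 : ℝ))).mono_fun'
    (aestronglyMeasurable_haagerupLiftIntegrand z _)
    ((MeasureTheory.ae_restrict_iff' measurableSet_uIoc).2 (ae_norm_haagerupLiftIntegrand_le hz))

theorem haagerupLiftFactor_neg (z : ℂ) : haagerupLiftFactor (-z) = haagerupLiftFactor z := by
  simp [haagerupLiftFactor, haagerupLiftIntegrand]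

theorem norm_haagerupLiftFactor_le (hz : |z.re| ≤ π / 2) : ‖haagerupLiftFactor z‖ ≤ 2 := by
  simpa [haagerupLiftFactor] using intervalIntegral.norm_integral_le_of_norm_le_const_ae
    (ae_norm_haagerupLiftIntegrand_le hz)

theorem continuousWithinAt_haagerupLiftFactor (hz : |z.re| ≤ π / 2) (hz0 : z ≠ 0) :
    ContinuousWithinAt haagerupLiftFactor {z | |z.re| ≤ π / 2} z := by
  refine intervalIntegral.continuousWithinAt_of_dominated_interval (bound := fun _ => (2 : ℝ))
    (.of_forall fun w => aestronglyMeasurable_haagerupLiftIntegrand w _) ?_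
    intervalIntegrable_const ?_
  · filter_upwards [self_mem_nhdsWithin] with w hw using ae_norm_haagerupLiftIntegrand_le hw
  · filter_upwards [ae_mem_uIoc_imp_mem_Ioo zero_le_one] with r hr hmem
    exact (differentiableAt_haagerupLiftIntegrand hz hz0
      (Ioo_subset_Ico_self (hr hmem))).continuousAt.continuousWithinAt

theorem isOpen_abs_re_lt (a : ℝ) : IsOpen {z : ℂ | |z.re| < a} :=
  isOpen_lt (by fun_prop) continuous_const

theorem differentiableAt_haagerupLiftFactor (hz : |z.re| < π / 2) (hz0 : z ≠ 0) :
    DifferentiableAt ℂ haagerupLiftFactor z := by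
  have hU : {w : ℂ | |w.re| < π / 2 ∧ w ≠ 0} ∈ 𝓝 z :=
    ((isOpen_abs_re_lt (π / 2)).inter isOpen_ne).mem_nhds ⟨hz, hz0⟩
  refine differentiableAt_intervalIntegral_of_norm_le (C := 2) hU
    (fun w _ => aestronglyMeasurable_haagerupLiftIntegrand w _) ?_ ?_
  · filter_upwards [ae_mem_uIoc_imp_mem_Ioo zero_le_one] with r hr hmem w hw
    exact (differentiableAt_haagerupLiftIntegrand hw.1.le hw.2
      (Ioo_subset_Ico_self (hr hmem))).differentiableWithinAt
  · filter_upwards [ae_mem_uIoc_imp_mem_Ioo zero_le_one] with r hr hmem w hw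
    exact norm_haagerupLiftIntegrand_le hw.1.le (Ioo_subset_Ico_self (hr hmem))

theorem re_haagerupLiftFactor_pos (hz : |z.re| ≤ π / 2) (hz0 : z ≠ 0) :
    0 < (haagerupLiftFactor z).re := by
  have hint := intervalIntegrable_haagerupLiftIntegrand hz
  have hre : (haagerupLiftFactor z).re = ∫ r in (0 : ℝ)..1, (haagerupLiftIntegrand z r).re :=
    (Complex.reCLM.intervalIntegral_comp_comm hint).symm
  rw [hre]
  exact intervalIntegral.intervalIntegral_pos_of_pos_on ⟨hint.1.re, hint.2.re⟩
    (fun r hr => re_complex_sqrt_pos (re_one_sub_sq_pos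
      (norm_sin_mul_div_sin_lt_one hz hz0 (Ioo_subset_Ico_self hr)))) zero_lt_one

theorem haagerupLiftFactor_conj (hz : |z.re| ≤ π / 2) (hz0 : z ≠ 0) :
    haagerupLiftFactor (starRingEnd ℂ z) = starRingEnd ℂ (haagerupLiftFactor z) := by
  refine Eq.trans ?_ (Complex.conjCLE.toContinuousLinearMap.intervalIntegral_comp_comm
    (intervalIntegrable_haagerupLiftIntegrand hz))
  refine intervalIntegral.integral_congr_ae ?_
  filter_upwards [ae_mem_uIoc_imp_mem_Ioo zero_le_one] with r hr hmem
  have hsin : Complex.sin (r * starRingEnd ℂ z) = starRingEnd ℂ (Complex.sin (r * z)) := by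
    rw [← Complex.sin_conj, map_mul, Complex.conj_ofReal]
  have harg := Complex.slitPlane_arg_ne_pi
    (one_sub_sq_sin_mul_div_sin_mem_slitPlane hz hz0 (Ioo_subset_Ico_self (hr hmem)))
  simpa [haagerupLiftIntegrand, Complex.sqrt, Complex.sin_conj, hsin, map_ofNat] using
    Complex.conj_cpow _ (2⁻¹ : ℂ) harg

theorem haagerupLiftFactor_ofReal {s : ℝ} (hs : |s| ≤ π / 2) (hs0 : s ≠ 0) :
    haagerupLiftFactor s = ((haagerupLiftFactor s).re : ℂ) := by
  have hconj := haagerupLiftFactor_conj (z := s) (by simpa using hs) (by simpa using hs0)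
  rw [Complex.conj_ofReal] at hconj
  exact (Complex.conj_eq_iff_re.1 hconj.symm).symm

theorem haagerupLiftFactor_mul_I {y : ℝ} (hy : y ≠ 0) :
    haagerupLiftFactor (y * I) = ((haagerupLiftFactor (y * I)).re : ℂ) := by
  have hconj := haagerupLiftFactor_conj (z := y * I)
    (by simpa using Real.pi_div_two_pos.le) (by simpa using hy)
  rw [map_mul, Complex.conj_ofReal, Complex.conj_I, mul_neg, haagerupLiftFactor_neg] at hconj
  exact (Complex.conj_eq_iff_re.1 hconj.symm).symm

@[simp] theorem haagerupLift_zero : haagerupLift 0 = 0 := zero_mul _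

theorem haagerupLift_neg (z : ℂ) : haagerupLift (-z) = -haagerupLift z := by
  rw [haagerupLift, haagerupLiftFactor_neg, neg_mul, haagerupLift]

theorem norm_haagerupLift_le (hz : |z.re| ≤ π / 2) : ‖haagerupLift z‖ ≤ 2 * ‖z‖ := by
  rw [haagerupLift, norm_mul, mul_comm]
  gcongr
  exact norm_haagerupLiftFactor_le hz

theorem continuousOn_haagerupLift : ContinuousOn haagerupLift {z | |z.re| ≤ π / 2} := by
  intro z hz
  rcases eq_or_ne z 0 with rfl | hz0
  · rw [ContinuousWithinAt, haagerupLift_zero]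
    refine squeeze_zero_norm' (a := fun z : ℂ => 2 * ‖z‖)
      (by filter_upwards [self_mem_nhdsWithin] with w hw using norm_haagerupLift_le hw) ?_
    have hcont : Continuous fun z : ℂ => 2 * ‖z‖ := by fun_prop
    simpa using (hcont.tendsto 0).mono_left nhdsWithin_le_nhds
  · exact continuousWithinAt_id.mul (continuousWithinAt_haagerupLiftFactor hz hz0)

theorem differentiableAt_haagerupLift (hz : |z.re| < π / 2) :
    DifferentiableAt ℂ haagerupLift z := by
  rcases eq_or_ne z 0 with rfl | hz0
  · have hstrip := (isOpen_abs_re_lt (π / 2)).mem_nhds hz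
    refine (Complex.analyticAt_of_differentiable_on_punctured_nhds_of_continuousAt ?_
      (continuousOn_haagerupLift.continuousAt ?_)).differentiableAt
    · filter_upwards [self_mem_nhdsWithin, nhdsWithin_le_nhds hstrip] with w hw0 hw
      exact differentiableAt_id.mul (differentiableAt_haagerupLiftFactor hw hw0)
    · filter_upwards [hstrip] with w hw using le_of_lt hw
  · exact differentiableAt_id.mul (differentiableAt_haagerupLiftFactor hz hz0)

theorem analyticAt_haagerupLift (hz : |z.re| < π / 2) : AnalyticAt ℂ haagerupLift z := by
  refine Complex.analyticAt_iff_eventually_differentiableAt.2 ?_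
  filter_upwards [(isOpen_abs_re_lt (π / 2)).mem_nhds hz] with w hw
  exact differentiableAt_haagerupLift hw

theorem haagerupLift_ne_zero (hz : |z.re| ≤ π / 2) (hz0 : z ≠ 0) : haagerupLift z ≠ 0 := by
  refine mul_ne_zero hz0 fun hfactor => ?_
  simpa [hfactor] using re_haagerupLiftFactor_pos hz hz0

theorem haagerupLift_mem_slitPlane (hz : |z.re| ≤ π / 2) (hz0 : z ≠ 0) (hre : 0 ≤ z.re) :
    haagerupLift z ∈ Complex.slitPlane := by
  have hpos : 0 < (haagerupLiftFactor z).re * Complex.normSq z :=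
    mul_pos (re_haagerupLiftFactor_pos hz hz0) (Complex.normSq_pos.2 hz0)
  have hdecomp : (haagerupLiftFactor z).re * Complex.normSq z
      = z.re * (haagerupLift z).re + z.im * (haagerupLift z).im := by
    rw [haagerupLift, Complex.mul_re, Complex.mul_im, Complex.normSq_apply]
    ring
  by_contra hmem
  rw [Complex.mem_slitPlane_iff, not_or, not_lt, not_not] at hmem
  rw [hmem.2, mul_zero, add_zero] at hdecomp
  linarith [mul_nonpos_of_nonneg_of_nonpos hre hmem.1]

theorem im_haagerupLift_ofReal {s : ℝ} (hs : |s| ≤ π / 2) : (haagerupLift s).im = 0 := by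
  rcases eq_or_ne s 0 with rfl | hs0
  · simp
  · rw [haagerupLift, haagerupLiftFactor_ofReal hs hs0, ← Complex.ofReal_mul, Complex.ofReal_im]

theorem re_haagerupLift_ofReal_pos {s : ℝ} (hs : 0 < s) (hs' : s ≤ π / 2) :
    0 < (haagerupLift s).re := by
  have habs : |s| ≤ π / 2 := (abs_of_pos hs).trans_le hs'
  rw [haagerupLift, Complex.re_ofReal_mul]
  exact mul_pos hs (re_haagerupLiftFactor_pos habs (Complex.ofReal_ne_zero.2 hs.ne'))

theorem re_haagerupLift_mul_I (y : ℝ) : (haagerupLift (y * I)).re = 0 := by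
  rcases eq_or_ne y 0 with rfl | hy
  · simp
  · rw [haagerupLift, haagerupLiftFactor_mul_I hy, Complex.re_mul_ofReal, Complex.re_ofReal_mul,
      Complex.I_re, mul_zero, zero_mul]

theorem im_haagerupLift_mul_I_pos {y : ℝ} (hy : 0 < y) : 0 < (haagerupLift (y * I)).im := by
  have hpos := re_haagerupLiftFactor_pos (z := y * I)
    (by simpa using Real.pi_div_two_pos.le) (by simpa using hy.ne')
  rw [haagerupLift, haagerupLiftFactor_mul_I hy.ne', Complex.im_mul_ofReal]
  simpa using mul_pos hy hpos

end Lift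

section Primitive

variable {f P : ℂ → ℂ} {y : ℝ}

theorem integral_comp_line_mul_eq_sub {z v : ℂ} {p q : ℝ}
    (hP : ∀ t ∈ uIcc p q, HasDerivAt P (f (z + t * v)) (z + t * v))
    (hf : ContinuousOn (fun t : ℝ => f (z + t * v)) (uIcc p q)) :
    ∫ t in p..q, f (z + t * v) * v = P (z + q * v) - P (z + p * v) := by
  refine intervalIntegral.integral_eq_sub_of_hasDerivAt (f := fun t : ℝ => P (z + t * v))
    (fun t ht => ?_) (hf.mul continuousOn_const).intervalIntegrable
  have hline : HasDerivAt (fun t : ℝ => z + (t : ℂ) * v) v t := by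
    simpa using ((Complex.ofRealCLM.hasDerivAt (x := t)).mul_const v).const_add z
  exact (hP t ht).comp t hline

theorem isOpen_abs_im_lt (y : ℝ) : IsOpen {w : ℂ | |w.im| < y} :=
  isOpen_lt (by fun_prop) continuous_const

theorem convex_abs_im_lt (y : ℝ) : Convex ℝ {w : ℂ | |w.im| < y} := by
  have hpre : {w : ℂ | |w.im| < y} = Complex.imLm ⁻¹' Ioo (-y) y := by ext w; simp [abs_lt]
  exact hpre ▸ (convex_Ioo (-y) y).linear_preimage Complex.imLm

theorem integral_ray_eq_of_differentiableOn_strip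
    (hf : DifferentiableOn ℂ f {w | |w.im| < y}) {a s : ℝ} (hs : |s| < y) :
    ∫ r in (0 : ℝ)..1, f (r * (a + s * I)) * (a + s * I)
      = (∫ t in (0 : ℝ)..a, f t) + (∫ u in (0 : ℝ)..s, f (a + u * I)) * I := by
  have hy : 0 < y := (abs_nonneg s).trans_lt hs
  obtain ⟨P, hP⟩ := (convex_abs_im_lt y).exists_forall_hasDerivWithinAt hf
  have hline (z v : ℂ) {p q : ℝ} (hmem : ∀ t ∈ uIcc p q, |(z + t * v).im| < y) :
      ∫ t in p..q, f (z + t * v) * v = P (z + q * v) - P (z + p * v) :=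
    integral_comp_line_mul_eq_sub
      (fun t ht => (hP _ (hmem t ht)).hasDerivAt ((isOpen_abs_im_lt y).mem_nhds (hmem t ht)))
      (hf.continuousOn.comp (by fun_prop) hmem)
  have hle {r s : ℝ} (hr : r ∈ uIcc 0 s) : |r| ≤ |s| := by
    simpa using abs_sub_left_of_mem_uIcc hr
  have hray := hline 0 (a + s * I) (p := 0) (q := 1) fun r hr => by
    have him : (0 + (r : ℂ) * (a + s * I)).im = r * s := by simp
    rw [him, abs_mul]
    exact (mul_le_of_le_one_left (abs_nonneg s) ((hle hr).trans_eq abs_one)).trans_lt hs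
  have hbottom := hline 0 1 (p := 0) (q := a) fun t _ => by simpa using hy
  have hedge := hline a I (p := 0) (q := s) fun u hu => by
    simpa using (hle hu).trans_lt hs
  rw [intervalIntegral.integral_mul_const] at hedge
  simp only [zero_add, mul_one, Complex.ofReal_zero, zero_mul, Complex.ofReal_one, one_mul,
    add_zero] at hray hbottom hedge
  rw [hray, hbottom, hedge]
  ring

theorem continuousWithinAt_integral_ray (hy : 0 < y)
    (hf : DifferentiableOn ℂ f {w | |w.im| < y}) {M : ℝ} (hM : ∀ w : ℂ, |w.im| < y → ‖f w‖ ≤ M)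
    {ζ : ℂ} (hζ : |ζ.im| ≤ y) :
    ContinuousWithinAt (fun ζ => ∫ r in (0 : ℝ)..1, f (r * ζ)) {w | |w.im| < y} ζ := by
  have hmem {r : ℝ} {w : ℂ} (hr : r ∈ Ioo 0 1) (hw : |w.im| ≤ y) : |((r : ℂ) * w).im| < y := by
    rw [Complex.im_ofReal_mul, abs_mul, abs_of_pos hr.1]
    exact (mul_le_mul_of_nonneg_left hw hr.1.le).trans_lt (mul_lt_of_lt_one_left hy hr.2)
  refine intervalIntegral.continuousWithinAt_of_dominated_interval (bound := fun _ => M)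
    ?_ ?_ intervalIntegrable_const ?_
  · filter_upwards [self_mem_nhdsWithin] with w hw
    refine (hf.continuousOn.comp (by fun_prop) fun r hr => ?_).aestronglyMeasurable
      measurableSet_uIoc
    rw [uIoc_of_le zero_le_one] at hr
    rw [mem_ofPred_eq, Complex.im_ofReal_mul, abs_mul, abs_of_pos hr.1]
    exact (mul_le_of_le_one_left (abs_nonneg _) hr.2).trans_lt hw
  · filter_upwards [self_mem_nhdsWithin] with w hw
    filter_upwards [ae_mem_uIoc_imp_mem_Ioo zero_le_one] with r hr hr_mem
    exact hM _ (hmem (hr hr_mem) (le_of_lt hw))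
  · filter_upwards [ae_mem_uIoc_imp_mem_Ioo zero_le_one] with r hr hr_mem
    have hf_diff := hf.differentiableAt ((isOpen_abs_im_lt y).mem_nhds (hmem (hr hr_mem) hζ))
    exact (hf_diff.continuousAt.comp (f := fun w : ℂ => (r : ℂ) * w)
      (by fun_prop)).continuousWithinAt

theorem integral_ray_eq_of_bounded_on_strip (hy : 0 < y)
    (hf : DifferentiableOn ℂ f {w | |w.im| < y}) {M : ℝ} (hM : ∀ w : ℂ, |w.im| < y → ‖f w‖ ≤ M)
    {a : ℝ} (hint : IntervalIntegrable (fun u : ℝ => f (a + u * I)) MeasureTheory.volume 0 y) :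
    ∫ r in (0 : ℝ)..1, f (r * (a + y * I)) * (a + y * I)
      = (∫ t in (0 : ℝ)..a, f t) + (∫ u in (0 : ℝ)..y, f (a + u * I)) * I := by
  have hne : (𝓝[Ioo 0 y] y).NeBot := by rw [nhdsWithin_Ioo_eq_nhdsLT hy]; infer_instance
  have hmaps : MapsTo (fun s : ℝ => (a : ℂ) + s * I) (Ioo 0 y) {w | |w.im| < y} :=
    fun s hs => by simpa [abs_of_pos hs.1] using hs.2
  have hray := ((continuousWithinAt_integral_ray hy hf hM (ζ := a + y * I)
    (by simp [abs_of_pos hy])).comp (f := fun s : ℝ => (a : ℂ) + s * I)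
    (by fun_prop) hmaps).mul (g := fun s : ℝ => (a : ℂ) + s * I) (by fun_prop)
  have hedge : Tendsto (fun s : ℝ => ∫ u in (0 : ℝ)..s, f (a + u * I))
      (𝓝[Ioo 0 y] y) (𝓝 (∫ u in (0 : ℝ)..y, f (a + u * I))) :=
    ((intervalIntegral.continuousOn_primitive_interval' hint left_mem_uIcc) y
      right_mem_uIcc).mono_left (nhdsWithin_mono y (Ioo_subset_Icc_self.trans Icc_subset_uIcc))
  rw [intervalIntegral.integral_mul_const]
  refine tendsto_nhds_unique (hray.tendsto.congr' ?_) ((hedge.mul_const I).const_add _)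
  filter_upwards [self_mem_nhdsWithin] with s hs
  rw [← integral_ray_eq_of_differentiableOn_strip hf ((abs_of_pos hs.1).trans_lt hs.2),
    intervalIntegral.integral_mul_const]
  rfl

end Primitive

theorem complex_sin_pi_div_two_add_mul_I (s : ℝ) :
    Complex.sin ((π / 2 : ℝ) + s * I) = Real.cosh s := by
  rw [add_comm, Complex.ofReal_div, Complex.ofReal_ofNat, Complex.sin_add_pi_div_two,
    Complex.cos_mul_I, Complex.ofReal_cosh]

theorem complex_cos_pi_div_two_add_mul_I (s : ℝ) :
    Complex.cos ((π / 2 : ℝ) + s * I) = -(Real.sinh s * I) := by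
  rw [add_comm, Complex.ofReal_div, Complex.ofReal_ofNat, Complex.cos_add_pi_div_two,
    Complex.sin_mul_I, Complex.ofReal_sinh]

theorem ofReal_sqrt_one_sub_sq {q : ℝ} (hq : |q| ≤ 1) :
    ((√(1 - q ^ 2) : ℝ) : ℂ) = Complex.sqrt (1 - (q : ℂ) ^ 2) := by
  rw [ofReal_sqrt (sub_nonneg.2 ((sq_le_one_iff_abs_le_one q).2 hq))]
  push_cast
  rfl

theorem haagerupLift_pi_div_two_add_mul_I {y : ℝ} (hy : 0 < y) :
    haagerupLift ((π / 2 : ℝ) + y * I)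
      = ((∫ t in (0 : ℝ)..(π / 2), √(1 - (Real.sin t / Real.cosh y) ^ 2) : ℝ) : ℂ)
        + ((∫ s in (0 : ℝ)..y, √(1 - (Real.cosh s / Real.cosh y) ^ 2) : ℝ) : ℂ) * I := by
  set f : ℂ → ℂ := fun w => Complex.sqrt (1 - (Complex.sin w / Real.cosh y) ^ 2) with hf
  have hcosh := Real.cosh_pos y
  have hlt {w : ℂ} (hw : |w.im| < y) : ‖Complex.sin w / Real.cosh y‖ < 1 := by
    rw [norm_div, Complex.norm_real, Real.norm_of_nonneg hcosh.le, div_lt_one hcosh]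
    exact (norm_complex_sin_le_cosh_im w).trans_lt
      (Real.cosh_lt_cosh.2 (hw.trans_eq (abs_of_pos hy).symm))
  have hdiff : DifferentiableOn ℂ f {w | |w.im| < y} := fun w hw =>
    ((Complex.differentiableAt_sqrt (Or.inl (re_one_sub_sq_pos (hlt hw)))).comp
      (f := fun w => 1 - (Complex.sin w / Real.cosh y) ^ 2) w
      (by fun_prop)).differentiableWithinAt
  have hbottom (t : ℝ) : f t = (√(1 - (Real.sin t / Real.cosh y) ^ 2) : ℝ) := by
    rw [ofReal_sqrt_one_sub_sq]
    · simp [hf]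
    · rw [abs_div, abs_of_pos hcosh, div_le_one hcosh]
      exact (Real.abs_sin_le_one t).trans (Real.one_le_cosh y)
  have hedge : ∀ s ∈ uIcc 0 y,
      f ((π / 2 : ℝ) + s * I) = (√(1 - (Real.cosh s / Real.cosh y) ^ 2) : ℝ) := by
    intro s hs
    rw [uIcc_of_le hy.le] at hs
    simp only [hf, complex_sin_pi_div_two_add_mul_I]
    rw [ofReal_sqrt_one_sub_sq, Complex.ofReal_div]
    rw [abs_div, abs_of_pos hcosh, abs_of_pos (Real.cosh_pos s), div_le_one hcosh,
      Real.cosh_le_cosh, abs_of_nonneg hs.1, abs_of_pos hy]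
    exact hs.2
  have hedge_cont : ContinuousOn (fun s : ℝ => f ((π / 2 : ℝ) + s * I)) (uIcc 0 y) :=
    ContinuousOn.congr (by fun_prop) hedge
  have hray := integral_ray_eq_of_bounded_on_strip hy hdiff
    (fun w hw => norm_sqrt_one_sub_sq_le (hlt hw).le) hedge_cont.intervalIntegrable
  rw [intervalIntegral.integral_congr hedge, intervalIntegral.integral_congr fun t _ => hbottom t,
    intervalIntegral.integral_ofReal, intervalIntegral.integral_ofReal,
    intervalIntegral.integral_mul_const] at hray
  rw [haagerupLift, mul_comm, ← hray, haagerupLiftFactor]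
  simp only [haagerupLiftIntegrand, hf, complex_sin_pi_div_two_add_mul_I]

theorem haagerupLift_ofReal {s : ℝ} (hs : 0 < s) (hs' : s ≤ π / 2) :
    haagerupLift s = ((∫ t in (0 : ℝ)..s, √(1 - (Real.sin t / Real.sin s) ^ 2) : ℝ) : ℂ) := by
  have hscale := intervalIntegral.mul_integral_comp_mul_right (a := 0) (b := 1)
    (f := fun t => √(1 - (Real.sin t / Real.sin s) ^ 2)) s
  rw [zero_mul, one_mul] at hscale
  rw [← hscale, Complex.ofReal_mul, haagerupLift, haagerupLiftFactor,
    ← intervalIntegral.integral_ofReal]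
  congr 1
  refine intervalIntegral.integral_congr fun r hr => ?_
  rw [uIcc_of_le zero_le_one] at hr
  have hle : |Real.sin (r * s) / Real.sin s| ≤ 1 := by
    have hrs : 0 ≤ r * s := mul_nonneg hr.1 hs.le
    have hrs_le : r * s ≤ s := mul_le_of_le_one_left hs.le hr.2
    have hsin : 0 < Real.sin s := Real.sin_pos_of_pos_of_lt_pi hs (by linarith)
    rw [abs_div, abs_of_pos hsin, div_le_one hsin,
      abs_of_nonneg (Real.sin_nonneg_of_nonneg_of_le_pi hrs (by linarith))]
    exact Real.sin_le_sin_of_le_of_le_pi_div_two (by linarith) hs' hrs_le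
  simp [haagerupLiftIntegrand, ofReal_sqrt_one_sub_sq hle]

theorem realHaagerup_eq_integral {x : ℝ} (hx : x ∈ Ioo 0 1) :
    realHaagerup x = ∫ t in (0 : ℝ)..(Real.arcsin x), √(1 - (Real.sin t / x) ^ 2) := by
  have hlt (t : ℝ) : x * Real.sin t ∈ Ioo (-1) 1 := by
    rw [mem_Ioo, ← abs_lt, abs_mul, abs_of_pos hx.1]
    exact (mul_le_of_le_one_right hx.1.le (Real.abs_sin_le_one t)).trans_lt hx.2
  have hpos (t : ℝ) : 0 < 1 - (x * Real.sin t) ^ 2 := by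
    linarith [(sq_lt_one_iff_abs_lt_one _).2 (abs_lt.2 (hlt t))]
  have hsubst := intervalIntegral.integral_comp_mul_deriv (a := 0) (b := π / 2)
    (f := fun t => Real.arcsin (x * Real.sin t))
    (f' := fun t => 1 / √(1 - (x * Real.sin t) ^ 2) * (x * Real.cos t))
    (g := fun w => √(1 - (Real.sin w / x) ^ 2))
    (fun t _ => HasDerivAt.comp (h₂ := Real.arcsin) t
      (Real.hasDerivAt_arcsin (hlt t).1.ne' (hlt t).2.ne)
      ((Real.hasDerivAt_sin t).const_mul x))
    ((ContinuousOn.div continuousOn_const (by fun_prop) fun t _ =>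
      (Real.sqrt_pos.2 (hpos t)).ne').mul (by fun_prop)) (by fun_prop)
  simp only [Real.sin_zero, mul_zero, Real.arcsin_zero, Real.sin_pi_div_two, mul_one] at hsubst
  rw [← hsubst, realHaagerup, ← intervalIntegral.integral_const_mul]
  refine intervalIntegral.integral_congr fun t ht => ?_
  rw [uIcc_of_le Real.pi_div_two_pos.le] at ht
  have hcos : 0 ≤ Real.cos t := Real.cos_nonneg_of_mem_Icc ⟨by linarith [ht.1, Real.pi_pos], ht.2⟩
  simp only [Function.comp_apply]
  rw [Real.sin_arcsin (hlt t).1.le (hlt t).2.le, mul_div_cancel_left₀ _ hx.1.ne', ← Real.cos_sq',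
    Real.sqrt_sq hcos, mul_pow]
  ring

theorem haagerupLift_ofReal_eq_realHaagerup {s : ℝ} (hs : 0 < s) (hs' : s < π / 2) :
    haagerupLift s = realHaagerup (Real.sin s) := by
  have hsin : Real.sin s ∈ Ioo (0 : ℝ) 1 := by
    refine ⟨Real.sin_pos_of_pos_of_lt_pi hs (by linarith), ?_⟩
    rw [← Real.sin_pi_div_two]
    exact Real.sin_lt_sin_of_lt_of_le_pi_div_two (by linarith) le_rfl hs'
  rw [haagerupLift_ofReal hs hs'.le, realHaagerup_eq_integral hsin,
    Real.arcsin_sin (by linarith) hs'.le]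

theorem hasDerivAt_intervalIntegral_of_continuousOn {F F' : ℝ → ℝ → ℝ} {a b x₀ : ℝ} {U : Set ℝ}
    (hU : U ∈ 𝓝 x₀) (hF : ∀ x ∈ U, ContinuousOn (F x) (uIcc a b))
    (hF' : ContinuousOn (fun p : ℝ × ℝ => F' p.1 p.2) (U ×ˢ uIcc a b))
    (hderiv : ∀ x ∈ U, ∀ t ∈ uIcc a b, HasDerivAt (fun x => F x t) (F' x t) x) :
    HasDerivAt (fun x => ∫ t in a..b, F x t) (∫ t in a..b, F' x₀ t) x₀ := by
  obtain ⟨K, hK, hKU, hK_compact⟩ := local_compact_nhds hU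
  obtain ⟨C, hC⟩ := (hK_compact.prod isCompact_uIcc).exists_bound_of_continuousOn
    (hF'.mono (prod_mono_left hKU))
  have hx₀ : x₀ ∈ U := mem_of_mem_nhds hU
  have hF'_cont : ContinuousOn (F' x₀) (uIcc a b) :=
    hF'.comp (f := fun t => (x₀, t)) (by fun_prop) fun t ht => ⟨hx₀, ht⟩
  refine (intervalIntegral.hasDerivAt_integral_of_dominated_loc_of_deriv_le (bound := fun _ => C)
    hK ?_ (hF x₀ hx₀).intervalIntegrable
    ((hF'_cont.mono uIoc_subset_uIcc).aestronglyMeasurable measurableSet_uIoc) ?_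
    intervalIntegrable_const ?_).2
  · filter_upwards [hU] with x hx
    exact ((hF x hx).mono uIoc_subset_uIcc).aestronglyMeasurable measurableSet_uIoc
  · exact .of_forall fun t ht x hx => hC (x, t) ⟨hx, uIoc_subset_uIcc ht⟩
  · exact .of_forall fun t ht x hx => hderiv x (hKU hx) t (uIoc_subset_uIcc ht)

/-- The complete elliptic integral of the second kind, as a function of the parameter `m = k²`. -/
noncomputable def ellipticE (m : ℝ) : ℝ :=
  ∫ t in (0 : ℝ)..(π / 2), √(1 - m * Real.sin t ^ 2)

/-- The difference `K - E` of the complete elliptic integrals of the first and second kinds,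
as a function of the parameter `m = k²`. -/
noncomputable def ellipticKSubE (m : ℝ) : ℝ :=
  ∫ t in (0 : ℝ)..(π / 2), m * Real.sin t ^ 2 / √(1 - m * Real.sin t ^ 2)

section Elliptic

variable {m : ℝ}

theorem le_one_sub_mul_sin_sq {d : ℝ} (hd : d ≤ 1) (hm : m ≤ 1 - d) (t : ℝ) :
    d ≤ 1 - m * Real.sin t ^ 2 := by
  have hmul : m * Real.sin t ^ 2 ≤ (1 - d) * Real.sin t ^ 2 := by gcongr
  linarith [mul_le_of_le_one_right (sub_nonneg.2 hd) (Real.sin_sq_le_one t)]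

theorem one_sub_mul_sin_sq_pos (hm : m < 1) (t : ℝ) : 0 < 1 - m * Real.sin t ^ 2 :=
  (lt_min one_pos (sub_pos.2 hm)).trans_le
    (le_one_sub_mul_sin_sq (min_le_left _ _) (by linarith [min_le_right 1 (1 - m)]) t)

theorem sqrt_one_sub_mul_sin_sq_le_one (hm : 0 ≤ m) (t : ℝ) : √(1 - m * Real.sin t ^ 2) ≤ 1 :=
  Real.sqrt_le_one.2 (by linarith [mul_nonneg hm (sq_nonneg (Real.sin t))])

theorem continuous_ellipticKSubE_integrand (hm : m < 1) :
    Continuous fun t => m * Real.sin t ^ 2 / √(1 - m * Real.sin t ^ 2) :=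
  Continuous.div (by fun_prop) (by fun_prop) fun t =>
    (Real.sqrt_pos.2 (one_sub_mul_sin_sq_pos hm t)).ne'

theorem continuous_ellipticE : Continuous ellipticE :=
  intervalIntegral.continuous_parametric_intervalIntegral_of_continuous' (by fun_prop) _ _

theorem ellipticE_zero : ellipticE 0 = π / 2 := by simp [ellipticE]

theorem ellipticE_one : ellipticE 1 = 1 := by
  have hcos : ∀ t ∈ uIcc 0 (π / 2), √(1 - 1 * Real.sin t ^ 2) = Real.cos t := by
    intro t ht
    rw [uIcc_of_le Real.pi_div_two_pos.le] at ht
    rw [one_mul, ← Real.cos_sq',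
      Real.sqrt_sq (Real.cos_nonneg_of_mem_Icc ⟨by linarith [ht.1, Real.pi_pos], ht.2⟩)]
  rw [ellipticE, intervalIntegral.integral_congr hcos]
  simp

theorem antitone_ellipticE : Antitone ellipticE := fun m n hmn =>
  intervalIntegral.integral_mono_on Real.pi_div_two_pos.le
    (Continuous.intervalIntegrable (by fun_prop) _ _)
    (Continuous.intervalIntegrable (by fun_prop) _ _) fun t _ => by gcongr

theorem one_le_ellipticE (hm : m ≤ 1) : 1 ≤ ellipticE m :=
  ellipticE_one.symm.trans_le (antitone_ellipticE hm)

theorem ellipticE_le (hm : 0 ≤ m) : ellipticE m ≤ π / 2 :=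
  (antitone_ellipticE hm).trans_eq ellipticE_zero

theorem le_ellipticKSubE (h0 : 0 ≤ m) (h1 : m < 1) : m * (π / 4) ≤ ellipticKSubE m := by
  have hint : ∫ t in (0 : ℝ)..(π / 2), m * Real.sin t ^ 2 = m * (π / 4) := by
    rw [intervalIntegral.integral_const_mul, integral_sin_sq, Real.sin_zero, Real.cos_pi_div_two]
    ring
  rw [← hint]
  exact intervalIntegral.integral_mono_on Real.pi_div_two_pos.le
    (Continuous.intervalIntegrable (by fun_prop) _ _)
    ((continuous_ellipticKSubE_integrand h1).intervalIntegrable _ _) fun t _ =>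
      le_div_self (by positivity) (Real.sqrt_pos.2 (one_sub_mul_sin_sq_pos h1 t))
        (sqrt_one_sub_mul_sin_sq_le_one h0 t)

theorem ellipticKSubE_le {d : ℝ} (h0 : 0 ≤ m) (hd : 0 < d) (hmd : m ≤ 1 - d ^ 2) :
    ellipticKSubE m ≤ m / d * (π / 2) := by
  have hint : ∫ _ in (0 : ℝ)..(π / 2), m / d = m / d * (π / 2) := by
    rw [intervalIntegral.integral_const, sub_zero, smul_eq_mul, mul_comm]
  have hd_sq : 0 < d ^ 2 := by positivity
  rw [← hint]
  refine intervalIntegral.integral_mono_on Real.pi_div_two_pos.le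
    ((continuous_ellipticKSubE_integrand (by linarith)).intervalIntegrable _ _)
    intervalIntegrable_const fun t _ => ?_
  exact div_le_div₀ h0 (mul_le_of_le_one_right h0 (Real.sin_sq_le_one t)) hd
    (Real.le_sqrt_of_sq_le (le_one_sub_mul_sin_sq (by linarith) hmd t))

theorem hasDerivAt_ellipticE (h0 : m ≠ 0) (h1 : m < 1) :
    HasDerivAt ellipticE (-(ellipticKSubE m / (2 * m))) m := by
  have hsqrt {x : ℝ} (hx : x < 1) (t : ℝ) := Real.sqrt_pos.2 (one_sub_mul_sin_sq_pos hx t)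
  refine (hasDerivAt_intervalIntegral_of_continuousOn
    (F' := fun x t => -Real.sin t ^ 2 / (2 * √(1 - x * Real.sin t ^ 2))) (Iio_mem_nhds h1)
    (fun x _ => by fun_prop) ?_ fun x hx t _ => ?_).congr_deriv ?_
  · exact ContinuousOn.div (by fun_prop) (by fun_prop) fun p hp =>
      mul_ne_zero two_ne_zero (hsqrt hp.1 p.2).ne'
  · simpa using (((hasDerivAt_id x).mul_const (Real.sin t ^ 2)).const_sub 1).sqrt
      (one_sub_mul_sin_sq_pos hx t).ne'
  · rw [ellipticKSubE, ← intervalIntegral.integral_div, ← intervalIntegral.integral_neg]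
    refine intervalIntegral.integral_congr fun t _ => ?_
    field [hsqrt h1 t]

theorem hasDerivAt_sin_mul_cos_div_sqrt (hm : m < 1) (t : ℝ) :
    HasDerivAt (fun t => Real.sin t * Real.cos t / √(1 - m * Real.sin t ^ 2))
      ((1 - 2 * Real.sin t ^ 2 + m * Real.sin t ^ 4) / √(1 - m * Real.sin t ^ 2) ^ 3) t := by
  have hpos := one_sub_mul_sin_sq_pos hm t
  have hsqrt := Real.sqrt_pos.2 hpos
  have hsq := Real.sq_sqrt hpos.le
  have hnum := (Real.hasDerivAt_sin t).mul (Real.hasDerivAt_cos t)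
  have hden := ((((Real.hasDerivAt_sin t).pow 2).const_mul m).const_sub 1).sqrt hpos.ne'
  refine (hnum.div hden hsqrt.ne').congr_deriv ?_
  simp only [Pi.mul_apply, Pi.pow_apply]
  generalize √(1 - m * Real.sin t ^ 2) = q at *
  push_cast
  field_simp
  rw [hsq, Real.cos_sq']
  ring

theorem hasDerivAt_ellipticKSubE_integrand (hm : m < 1) (t : ℝ) :
    HasDerivAt (fun m => m * Real.sin t ^ 2 / √(1 - m * Real.sin t ^ 2))
      (Real.sin t ^ 2 * (2 - m * Real.sin t ^ 2) / (2 * √(1 - m * Real.sin t ^ 2) ^ 3)) m := by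
  have hpos := one_sub_mul_sin_sq_pos hm t
  have hsqrt := Real.sqrt_pos.2 hpos
  have hsq := Real.sq_sqrt hpos.le
  have hnum := (hasDerivAt_id m).mul_const (Real.sin t ^ 2)
  refine (hnum.div ((hnum.const_sub 1).sqrt hpos.ne') hsqrt.ne').congr_deriv ?_
  simp only [id]
  set q := √(1 - m * Real.sin t ^ 2)
  field_simp
  rw [hsq]
  ring

theorem hasDerivAt_ellipticKSubE (hm : m < 1) :
    HasDerivAt ellipticKSubE (ellipticE m / (2 * (1 - m))) m := by
  have hsqrt {x : ℝ} (hx : x < 1) (t : ℝ) := Real.sqrt_pos.2 (one_sub_mul_sin_sq_pos hx t)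
  have htotal_cont : Continuous fun t =>
      (1 - 2 * Real.sin t ^ 2 + m * Real.sin t ^ 4) / √(1 - m * Real.sin t ^ 2) ^ 3 :=
    Continuous.div (by fun_prop) (by fun_prop) fun t => (pow_pos (hsqrt hm t) 3).ne'
  have htotal : ∫ t in (0 : ℝ)..(π / 2),
      (1 - 2 * Real.sin t ^ 2 + m * Real.sin t ^ 4) / √(1 - m * Real.sin t ^ 2) ^ 3 = 0 := by
    rw [intervalIntegral.integral_eq_sub_of_hasDerivAt
      (fun t _ => hasDerivAt_sin_mul_cos_div_sqrt hm t) (htotal_cont.intervalIntegrable _ _)]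
    simp
  refine (hasDerivAt_intervalIntegral_of_continuousOn (Iio_mem_nhds hm)
    (fun x hx => (continuous_ellipticKSubE_integrand hx).continuousOn) ?_
    fun x hx t _ => hasDerivAt_ellipticKSubE_integrand hx t).congr_deriv ?_
  · exact ContinuousOn.div (by fun_prop) (by fun_prop) fun p hp =>
      mul_ne_zero two_ne_zero (pow_pos (hsqrt hp.1 p.2) 3).ne'
  · have hE_cont : Continuous fun t => √(1 - m * Real.sin t ^ 2) := by fun_prop
    have hE := intervalIntegral.integral_sub (μ := MeasureTheory.volume)
      (hE_cont.intervalIntegrable 0 (π / 2)) (htotal_cont.intervalIntegrable 0 (π / 2))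
    rw [htotal, sub_zero] at hE
    rw [ellipticE, ← hE, ← intervalIntegral.integral_div]
    refine intervalIntegral.integral_congr fun t _ => ?_
    have hpos := hsqrt hm t
    have hsq := Real.sq_sqrt (one_sub_mul_sin_sq_pos hm t).le
    have hm' : 1 - m ≠ 0 := (sub_pos.2 hm).ne'
    set q := √(1 - m * Real.sin t ^ 2)
    field_simp
    linear_combination (-(q ^ 2) - (1 - m * Real.sin t ^ 2)) * hsq

theorem tendsto_ellipticKSubE_mul :
    Tendsto (fun m => ellipticKSubE m * ellipticKSubE (1 - m)) (𝓝[>] 0) (𝓝 0) := by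
  have hbound : Tendsto (fun m : ℝ => √m * (π ^ 2 / 2)) (𝓝[>] 0) (𝓝 0) := by
    have hcont : Continuous fun m : ℝ => √m * (π ^ 2 / 2) := by fun_prop
    simpa using (hcont.tendsto 0).mono_left nhdsWithin_le_nhds
  have hsmall : ∀ᶠ m : ℝ in 𝓝[>] 0, m ∈ Ioo 0 (3 / 4) := Ioo_mem_nhdsGT (by norm_num)
  refine squeeze_zero' ?_ ?_ hbound
  · filter_upwards [hsmall] with m hm
    have hm' : 0 ≤ 1 - m := by linarith [hm.2]
    exact mul_nonneg
      ((mul_nonneg hm.1.le (by positivity)).trans (le_ellipticKSubE hm.1.le (by linarith [hm.2])))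
      ((mul_nonneg hm' (by positivity)).trans (le_ellipticKSubE hm' (by linarith [hm.1])))
  · filter_upwards [hsmall] with m ⟨hm0, hm1⟩
    have hm' : 0 ≤ 1 - m := by linarith
    have hsqrt := Real.sqrt_pos.2 hm0
    have hsq := Real.sq_sqrt hm0.le
    have hleft : ellipticKSubE m ≤ m * π :=
      (ellipticKSubE_le (d := 1 / 2) hm0.le (by norm_num) (by linarith)).trans_eq (by ring)
    have hright : ellipticKSubE (1 - m) ≤ 1 / √m * (π / 2) :=
      (ellipticKSubE_le hm' hsqrt (by linarith)).trans (by gcongr; linarith)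
    calc ellipticKSubE m * ellipticKSubE (1 - m) ≤ m * π * (1 / √m * (π / 2)) :=
          mul_le_mul hleft hright ((mul_nonneg hm' (by positivity)).trans
            (le_ellipticKSubE hm' (by linarith))) (by positivity)
      _ = √m * (π ^ 2 / 2) := by field_simp; rw [hsq]

theorem legendre_relation (h0 : 0 < m) (h1 : m < 1) :
    ellipticE m * ellipticE (1 - m) - ellipticKSubE m * ellipticKSubE (1 - m) = π / 2 := by
  set L : ℝ → ℝ := fun m =>
    ellipticE m * ellipticE (1 - m) - ellipticKSubE m * ellipticKSubE (1 - m) with hL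
  have hderiv : ∀ x ∈ Ioo (0 : ℝ) 1, HasDerivAt L 0 x := by
    intro x ⟨hx0, hx1⟩
    have hx' : 0 < 1 - x := sub_pos.2 hx1
    have hE := hasDerivAt_ellipticE hx0.ne' hx1
    have hK := hasDerivAt_ellipticKSubE hx1
    have hE' := (hasDerivAt_ellipticE hx'.ne' (by linarith)).comp_const_sub 1 x
    have hK' := (hasDerivAt_ellipticKSubE (m := 1 - x) (by linarith)).comp_const_sub 1 x
    refine ((hE.mul hE').sub (hK.mul hK')).congr_deriv ?_
    rw [sub_sub_cancel]
    field_simp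
    ring
  obtain ⟨c, hc⟩ := isOpen_Ioo.exists_is_const_of_deriv_eq_zero isPreconnected_Ioo
    (fun x hx => (hderiv x hx).differentiableAt.differentiableWithinAt)
    (fun x hx => (hderiv x hx).deriv)
  have hE_lim : Tendsto (fun m => ellipticE m * ellipticE (1 - m)) (𝓝[>] 0) (𝓝 (π / 2)) := by
    have hcont : Continuous fun m => ellipticE m * ellipticE (1 - m) :=
      continuous_ellipticE.mul (continuous_ellipticE.comp (by fun_prop))
    simpa [ellipticE_zero, ellipticE_one] using (hcont.tendsto 0).mono_left nhdsWithin_le_nhds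
  have hlim : Tendsto L (𝓝[>] 0) (𝓝 (π / 2)) := by
    simpa [hL] using hE_lim.sub tendsto_ellipticKSubE_mul
  have hconst : L =ᶠ[𝓝[>] 0] fun _ => c := by
    filter_upwards [Ioo_mem_nhdsGT one_pos] with x hx using hc x hx
  exact (hc m ⟨h0, h1⟩).trans (tendsto_nhds_unique (tendsto_const_nhds.congr' hconst.symm) hlim)

end Elliptic

theorem one_div_cosh_sq_mem_Ioo {y : ℝ} (hy : y ≠ 0) : 1 / Real.cosh y ^ 2 ∈ Ioo 0 1 := by
  refine ⟨by positivity, ?_⟩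
  rw [div_lt_one (by positivity)]
  exact one_lt_pow₀ (Real.one_lt_cosh.2 hy) two_ne_zero

theorem hasDerivAt_one_div_cosh_sq (y : ℝ) :
    HasDerivAt (fun y => 1 / Real.cosh y ^ 2) (-(2 * Real.sinh y / Real.cosh y ^ 3)) y := by
  have hcosh := Real.cosh_pos y
  simp only [one_div]
  refine (((Real.hasDerivAt_cosh y).pow 2).inv (pow_pos hcosh 2).ne').congr_deriv ?_
  simp only [Pi.pow_apply]
  push_cast
  field_simp

theorem hasDerivAt_arsinh_sinh_mul_sin (y t : ℝ) :
    HasDerivAt (fun t => Real.arsinh (Real.sinh y * Real.sin t))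
      ((√(1 + (Real.sinh y * Real.sin t) ^ 2))⁻¹ * (Real.sinh y * Real.cos t)) t :=
  (Real.hasDerivAt_arsinh _).comp t ((Real.hasDerivAt_sin t).const_mul (Real.sinh y))

theorem sqrt_one_sub_cosh_arsinh_div_cosh_sq {y t : ℝ} (hy : 0 < y) (ht : 0 ≤ Real.cos t) :
    √(1 - (Real.cosh (Real.arsinh (Real.sinh y * Real.sin t)) / Real.cosh y) ^ 2)
      = Real.sinh y * Real.cos t / Real.cosh y := by
  have hnonneg : 0 ≤ Real.sinh y * Real.cos t / Real.cosh y :=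
    div_nonneg (mul_nonneg (Real.sinh_pos_iff.2 hy).le ht) (Real.cosh_pos y).le
  refine (congrArg Real.sqrt ?_).trans (Real.sqrt_sq hnonneg)
  rw [div_pow, Real.cosh_sq (Real.arsinh _), Real.sinh_arsinh]
  field_simp
  rw [Real.cosh_sq y, Real.sin_sq]
  ring

theorem sqrt_one_sub_one_sub_one_div_cosh_sq_mul (y t : ℝ) :
    √(1 - (1 - 1 / Real.cosh y ^ 2) * Real.cos t ^ 2)
      = √(1 + (Real.sinh y * Real.sin t) ^ 2) / Real.cosh y := by
  have hcosh := Real.cosh_pos y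
  rw [← Real.sqrt_sq hcosh.le, ← Real.sqrt_div' _ (by positivity), Real.sqrt_sq hcosh.le]
  congr 1
  field_simp
  rw [Real.cosh_sq y, Real.sin_sq]
  ring

theorem integral_sqrt_one_sub_cosh_div_cosh_sq {y : ℝ} (hy : 0 < y) :
    ∫ s in (0 : ℝ)..y, √(1 - (Real.cosh s / Real.cosh y) ^ 2)
      = ellipticKSubE (1 - 1 / Real.cosh y ^ 2) := by
  have hderiv_cont : Continuous fun t =>
      (√(1 + (Real.sinh y * Real.sin t) ^ 2))⁻¹ * (Real.sinh y * Real.cos t) :=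
    Continuous.mul (Continuous.inv₀ (by fun_prop) fun t => by positivity) (by fun_prop)
  have hsubst := intervalIntegral.integral_comp_mul_deriv (a := 0) (b := π / 2)
    (g := fun s => √(1 - (Real.cosh s / Real.cosh y) ^ 2))
    (fun t _ => hasDerivAt_arsinh_sinh_mul_sin y t) hderiv_cont.continuousOn (by fun_prop)
  have hflip := intervalIntegral.integral_comp_sub_left (a := 0) (b := π / 2)
    (fun t => (1 - 1 / Real.cosh y ^ 2) * Real.sin t ^ 2 /
      √(1 - (1 - 1 / Real.cosh y ^ 2) * Real.sin t ^ 2)) (π / 2)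
  simp only [Real.sin_zero, mul_zero, Real.arsinh_zero, Real.sin_pi_div_two, mul_one,
    Real.arsinh_sinh] at hsubst
  rw [sub_self, sub_zero] at hflip
  rw [← hsubst, ellipticKSubE, ← hflip]
  refine intervalIntegral.integral_congr fun t ht => ?_
  rw [uIcc_of_le Real.pi_div_two_pos.le] at ht
  have hcos : 0 ≤ Real.cos t :=
    Real.cos_nonneg_of_mem_Icc ⟨by linarith [ht.1, Real.pi_pos], ht.2⟩
  simp only [Function.comp, Real.sin_pi_div_two_sub, sqrt_one_sub_cosh_arsinh_div_cosh_sq hy hcos,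
    sqrt_one_sub_one_sub_one_div_cosh_sq_mul]
  field_simp
  rw [Real.cosh_sq y]
  ring

theorem ellipticKSubE_one_sub_one_div_cosh_sq_le {y : ℝ} (hy : 0 < y) :
    ellipticKSubE (1 - 1 / Real.cosh y ^ 2) ≤ y := by
  have hint : ∫ _ in (0 : ℝ)..y, (1 : ℝ) = y := by simp
  rw [← integral_sqrt_one_sub_cosh_div_cosh_sq hy]
  refine (intervalIntegral.integral_mono_on hy.le (Continuous.intervalIntegrable (by fun_prop) _ _)
    (Continuous.intervalIntegrable (by fun_prop) _ _) fun t _ => ?_).trans_eq hint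
  exact Real.sqrt_le_one.2 (by linarith [sq_nonneg (Real.cosh t / Real.cosh y)])

/-- The values of the lift on the vertical half-line above the singularity `π / 2`, which form the
right edge of the contour. -/
noncomputable def haagerupEdge (y : ℝ) : ℂ :=
  haagerupLift ((π / 2 : ℝ) + y * I)

theorem abs_re_pi_div_two_add_mul_I (y : ℝ) :
    |((π / 2 : ℝ) + y * I : ℂ).re| = π / 2 := by
  simp [abs_of_pos Real.pi_div_two_pos]

theorem haagerupEdge_mem_slitPlane (y : ℝ) : haagerupEdge y ∈ Complex.slitPlane := by
  have hre : ((π / 2 : ℝ) + y * I : ℂ).re = π / 2 := by simp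
  refine haagerupLift_mem_slitPlane (abs_re_pi_div_two_add_mul_I y).le (fun h => ?_) ?_
  · rw [h, Complex.zero_re] at hre
    exact Real.pi_div_two_pos.ne hre
  · exact Real.pi_div_two_pos.le.trans_eq hre.symm

theorem continuous_haagerupEdge : Continuous haagerupEdge :=
  continuousOn_haagerupLift.comp_continuous (by fun_prop) fun y =>
    (abs_re_pi_div_two_add_mul_I y).le

theorem haagerupEdge_eq {y : ℝ} (hy : 0 < y) :
    haagerupEdge y = ellipticE (1 / Real.cosh y ^ 2)
      + ellipticKSubE (1 - 1 / Real.cosh y ^ 2) * I := by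
  have hsq (t : ℝ) : (Real.sin t / Real.cosh y) ^ 2 = 1 / Real.cosh y ^ 2 * Real.sin t ^ 2 := by
    ring
  rw [haagerupEdge, haagerupLift_pi_div_two_add_mul_I hy,
    integral_sqrt_one_sub_cosh_div_cosh_sq hy, ellipticE]
  simp only [hsq]

theorem sq_norm_haagerupEdge {y : ℝ} (hy : 0 < y) :
    ‖haagerupEdge y‖ ^ 2 = ellipticE (1 / Real.cosh y ^ 2) ^ 2
      + ellipticKSubE (1 - 1 / Real.cosh y ^ 2) ^ 2 := by
  rw [haagerupEdge_eq hy, ← Complex.normSq_eq_norm_sq, Complex.normSq_add_mul_I]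

theorem hasDerivAt_haagerupEdge {y : ℝ} (hy : 0 < y) :
    HasDerivAt haagerupEdge (Real.tanh y * (ellipticKSubE (1 / Real.cosh y ^ 2)
      + ellipticE (1 - 1 / Real.cosh y ^ 2) * I)) y := by
  obtain ⟨hm0, hm1⟩ := one_div_cosh_sq_mem_Ioo hy.ne'
  have hm := hasDerivAt_one_div_cosh_sq y
  have hre : HasDerivAt (fun y => ellipticE (1 / Real.cosh y ^ 2))
      (Real.tanh y * ellipticKSubE (1 / Real.cosh y ^ 2)) y := by
    refine ((hasDerivAt_ellipticE hm0.ne' hm1).comp y hm).congr_deriv ?_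
    rw [Real.tanh_eq_sinh_div_cosh]
    field_simp
  have him : HasDerivAt (fun y => ellipticKSubE (1 - 1 / Real.cosh y ^ 2))
      (Real.tanh y * ellipticE (1 - 1 / Real.cosh y ^ 2)) y := by
    refine ((hasDerivAt_ellipticKSubE (m := 1 - 1 / Real.cosh y ^ 2) (by linarith)).comp y
      (hm.const_sub 1)).congr_deriv ?_
    rw [sub_sub_cancel, Real.tanh_eq_sinh_div_cosh]
    field_simp
  refine ((hre.ofReal_comp.add (him.ofReal_comp.mul_const I)).congr_of_eventuallyEq ?_).congr_deriv
    (by push_cast; ring)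
  filter_upwards [Ioi_mem_nhds hy] with x hx using haagerupEdge_eq hx

/-- The real part of `g' * conj g` for the edge curve `g`, up to the factor `tanh y`, in terms of
the elliptic parameter `m = 1 / cosh² y`; the imaginary part is the constant `π / 2` by Legendre's
relation. -/
noncomputable def edgeRadialSpeed (m : ℝ) : ℝ :=
  ellipticE m * ellipticKSubE m + ellipticKSubE (1 - m) * ellipticE (1 - m)

theorem hasDerivAt_log_haagerupEdge {y : ℝ} (hy : 0 < y) :
    HasDerivAt (fun y => Complex.log (haagerupEdge y))
      (((Real.tanh y * (edgeRadialSpeed (1 / Real.cosh y ^ 2) / ‖haagerupEdge y‖ ^ 2) : ℝ) : ℂ)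
        + ((Real.tanh y * (π / 2 / ‖haagerupEdge y‖ ^ 2) : ℝ) : ℂ) * I) y := by
  have hslit := haagerupEdge_mem_slitPlane y
  obtain ⟨hm0, hm1⟩ := one_div_cosh_sq_mem_Ioo hy.ne'
  have hnorm : ellipticE (1 / Real.cosh y ^ 2) ^ 2
      + ellipticKSubE (1 - 1 / Real.cosh y ^ 2) ^ 2 ≠ 0 := by
    rw [← sq_norm_haagerupEdge hy]
    exact pow_ne_zero 2 (norm_ne_zero_iff.2 (Complex.slitPlane_ne_zero hslit))
  refine ((hasDerivAt_haagerupEdge hy).clog_real hslit).congr_deriv ?_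
  rw [div_eq_iff (Complex.slitPlane_ne_zero hslit), sq_norm_haagerupEdge hy, haagerupEdge_eq hy,
    edgeRadialSpeed, ← legendre_relation hm0 hm1]
  generalize 1 / Real.cosh y ^ 2 = m at *
  rw [← Complex.ofReal_ne_zero] at hnorm
  push_cast at hnorm ⊢
  field_simp
  ring_nf
  rw [Complex.I_sq]
  ring

theorem hasDerivAt_log_norm_haagerupEdge {y : ℝ} (hy : 0 < y) :
    HasDerivAt (fun y => Real.log ‖haagerupEdge y‖)
      (Real.tanh y * (edgeRadialSpeed (1 / Real.cosh y ^ 2) / ‖haagerupEdge y‖ ^ 2)) y := by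
  have hre := Complex.reCLM.hasFDerivAt.comp_hasDerivAt y (hasDerivAt_log_haagerupEdge hy)
  simp only [Function.comp_def, Complex.reCLM_apply, Complex.log_re, Complex.add_re,
    Complex.ofReal_re, Complex.re_ofReal_mul, Complex.I_re, mul_zero, add_zero] at hre
  exact hre

theorem hasDerivAt_arg_haagerupEdge {y : ℝ} (hy : 0 < y) :
    HasDerivAt (fun y => Complex.arg (haagerupEdge y))
      (Real.tanh y * (π / 2 / ‖haagerupEdge y‖ ^ 2)) y := by
  have him := Complex.imCLM.hasFDerivAt.comp_hasDerivAt y (hasDerivAt_log_haagerupEdge hy)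
  simp only [Function.comp_def, Complex.imCLM_apply, Complex.log_im, Complex.add_im,
    Complex.ofReal_im, Complex.im_ofReal_mul, Complex.I_im, mul_one, zero_add] at him
  exact him

theorem ellipticKSubE_nonneg {m : ℝ} (h0 : 0 ≤ m) (h1 : m < 1) : 0 ≤ ellipticKSubE m :=
  (by positivity : 0 ≤ m * (π / 4)).trans (le_ellipticKSubE h0 h1)

section EllipticBounds

variable {m : ℝ}

theorem ellipticKSubE_one_sub_le_edgeRadialSpeed (hm : m ∈ Ioo 0 1) :
    ellipticKSubE (1 - m) ≤ edgeRadialSpeed m := by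
  have hE := one_le_ellipticE hm.2.le
  have hK := ellipticKSubE_nonneg hm.1.le hm.2
  have hK' : 0 ≤ ellipticKSubE (1 - m) :=
    ellipticKSubE_nonneg (by linarith [hm.2]) (by linarith [hm.1])
  have hE' : 1 ≤ ellipticE (1 - m) := one_le_ellipticE (by linarith [hm.1])
  rw [edgeRadialSpeed]
  nlinarith

theorem pi_div_four_le_edgeRadialSpeed (hm : m ∈ Ioo 0 1) : π / 4 ≤ edgeRadialSpeed m := by
  have hm' : 1 - m ∈ Ioo (0 : ℝ) 1 := ⟨by linarith [hm.2], by linarith [hm.1]⟩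
  calc π / 4 = m * (π / 4) + (1 - m) * (π / 4) := by ring
    _ ≤ ellipticKSubE m + ellipticKSubE (1 - m) :=
        add_le_add (le_ellipticKSubE hm.1.le hm.2) (le_ellipticKSubE hm'.1.le hm'.2)
    _ ≤ edgeRadialSpeed m :=
        add_le_add
          (le_mul_of_one_le_left (ellipticKSubE_nonneg hm.1.le hm.2) (one_le_ellipticE hm.2.le))
          (le_mul_of_one_le_right (ellipticKSubE_nonneg hm'.1.le hm'.2) (one_le_ellipticE hm'.2.le))

theorem sq_ellipticE_le (hm : m ∈ Ioo 0 1) : ellipticE m ^ 2 ≤ 5 / 2 := by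
  have hle : ellipticE m ^ 2 ≤ (π / 2) ^ 2 :=
    pow_le_pow_left₀ (zero_le_one.trans (one_le_ellipticE hm.2.le)) (ellipticE_le hm.1.le) 2
  nlinarith [Real.pi_lt_d2, Real.pi_pos]

end EllipticBounds

section Oscillation

variable {u φ S : ℝ → ℝ} {ν C κ : ℝ}

/-- A minorant of a primitive of `sinh y * exp (-ν u) * sin (ν φ)` along a curve with polar
coordinates `exp u` and `φ`. Its first summand comes from integrating by parts, using that
`sin (ν φ) * φ'` is the derivative of `(1 - cos (ν φ)) / ν`; the second one, with a free parameter
`κ`, absorbs a part of the positive remainder. -/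
noncomputable def polarMinorant (u φ : ℝ → ℝ) (ν C κ y : ℝ) : ℝ :=
  Real.cosh y * (Real.exp (-((ν - 2) * u y)) * (1 - Real.cos (ν * φ y))) / (ν * C)
    + κ * (φ y - Real.sin (ν * φ y) / ν)

theorem continuousOn_polarMinorant {s : Set ℝ} (hu : ContinuousOn u s) (hφ : ContinuousOn φ s) :
    ContinuousOn (polarMinorant u φ ν C κ) s := by
  unfold polarMinorant
  fun_prop

theorem hasDerivAt_polarMinorant {y : ℝ} (hν : ν ≠ 0) (hC : C ≠ 0)
    (hu : HasDerivAt u (Real.tanh y * (S y / Real.exp (u y) ^ 2)) y)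
    (hφ : HasDerivAt φ (Real.tanh y * (C / Real.exp (u y) ^ 2)) y) :
    HasDerivAt (polarMinorant u φ ν C κ)
      (Real.sinh y * (Real.exp (-(ν * u y)) * Real.sin (ν * φ y))
        - (1 - Real.cos (ν * φ y)) / (Real.exp (u y) ^ 2 * (ν * C))
          * (Real.sinh y * (Real.exp (-((ν - 2) * u y)) * ((ν - 2) * S y - Real.exp (u y) ^ 2))
            - Real.tanh y * (κ * ν * C ^ 2))) y := by
  have hexp : Real.exp (-((ν - 2) * u y)) = Real.exp (-(ν * u y)) * Real.exp (u y) ^ 2 := by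
    rw [← Real.exp_nat_mul, ← Real.exp_add]
    push_cast
    ring_nf
  have hcos := ((hφ.const_mul ν).cos).const_sub 1
  have hfirst := (((Real.hasDerivAt_cosh y).mul
    (((hu.const_mul (ν - 2)).neg.exp).mul hcos)).div_const (ν * C))
  have hsecond := (hφ.sub (((hφ.const_mul ν).sin).div_const ν)).const_mul κ
  refine (hfirst.add hsecond).congr_deriv ?_
  simp only [Pi.mul_apply, Pi.neg_apply, Real.tanh_eq_sinh_div_cosh]
  rw [hexp]
  field_simp
  ring

theorem polarMinorant_sub_le_integral {p q : ℝ} (hp : 0 ≤ p) (hpq : p ≤ q) (hν : 0 < ν)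
    (hC : 0 < C) (hκ : 0 ≤ κ) (hu : ContinuousOn u (Icc p q)) (hφ : ContinuousOn φ (Icc p q))
    (hu' : ∀ y ∈ Ioo p q, HasDerivAt u (Real.tanh y * (S y / Real.exp (u y) ^ 2)) y)
    (hφ' : ∀ y ∈ Ioo p q, HasDerivAt φ (Real.tanh y * (C / Real.exp (u y) ^ 2)) y)
    (hS : ∀ y ∈ Ioo p q, κ * ν * C ^ 2
      ≤ Real.exp (-((ν - 2) * u y)) * ((ν - 2) * S y - Real.exp (u y) ^ 2)) :
    polarMinorant u φ ν C κ q - polarMinorant u φ ν C κ p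
      ≤ ∫ y in p..q, Real.sinh y * (Real.exp (-(ν * u y)) * Real.sin (ν * φ y)) := by
  have hcont : ContinuousOn
      (fun y => Real.sinh y * (Real.exp (-(ν * u y)) * Real.sin (ν * φ y))) (Icc p q) := by
    fun_prop
  refine intervalIntegral.sub_le_integral_of_hasDeriv_right_of_le hpq
    (continuousOn_polarMinorant hu hφ)
    (fun y hy => (hasDerivAt_polarMinorant hν.ne' hC.ne' (hu' y hy) (hφ' y hy)).hasDerivWithinAt)
    hcont.integrableOn_Icc fun y hy => sub_le_self _ ?_
  have hsinh : 0 ≤ Real.sinh y := Real.sinh_nonneg_iff.2 (hp.trans hy.1.le)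
  have htanh : Real.tanh y ≤ Real.sinh y := by
    rw [Real.tanh_eq_sinh_div_cosh]
    exact div_le_self hsinh (Real.one_le_cosh y)
  exact mul_nonneg (div_nonneg (sub_nonneg.2 (Real.cos_le_one _)) (by positivity))
    (sub_nonneg.2 (mul_le_mul htanh (hS y hy) (by positivity) hsinh))

theorem le_integral_sinh_mul_exp_mul_sin {a b : ℝ} (ha : 0 ≤ a) (hab : a ≤ b) (hν : 0 < ν)
    (hC : 0 < C) (hκ : 0 ≤ κ) (hu : ContinuousOn u (Icc 0 b)) (hφ : ContinuousOn φ (Icc 0 b))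
    (hφ0 : φ 0 = 0)
    (hu' : ∀ y ∈ Ioo 0 b, HasDerivAt u (Real.tanh y * (S y / Real.exp (u y) ^ 2)) y)
    (hφ' : ∀ y ∈ Ioo 0 b, HasDerivAt φ (Real.tanh y * (C / Real.exp (u y) ^ 2)) y)
    (hS : ∀ y ∈ Ioo 0 b, Real.exp (u y) ^ 2 ≤ (ν - 2) * S y)
    (hSa : ∀ y ∈ Ioo 0 a, κ * ν * C ^ 2
      ≤ Real.exp (-((ν - 2) * u y)) * ((ν - 2) * S y - Real.exp (u y) ^ 2)) :
    κ * (φ a - 1 / ν)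
      ≤ ∫ y in (0 : ℝ)..b, Real.sinh y * (Real.exp (-(ν * u y)) * Real.sin (ν * φ y)) := by
  have hsub_left : Icc 0 a ⊆ Icc 0 b := Icc_subset_Icc_right hab
  have hsub_right : Icc a b ⊆ Icc 0 b := Icc_subset_Icc_left ha
  have hleft := polarMinorant_sub_le_integral le_rfl ha hν hC hκ (hu.mono hsub_left)
    (hφ.mono hsub_left) (fun y hy => hu' y ⟨hy.1, hy.2.trans_le hab⟩)
    (fun y hy => hφ' y ⟨hy.1, hy.2.trans_le hab⟩) hSa
  have hright := polarMinorant_sub_le_integral ha hab hν hC le_rfl (hu.mono hsub_right)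
    (hφ.mono hsub_right) (fun y hy => hu' y ⟨ha.trans_lt hy.1, hy.2⟩)
    (fun y hy => hφ' y ⟨ha.trans_lt hy.1, hy.2⟩) fun y hy => by
      rw [zero_mul, zero_mul]
      exact mul_nonneg (Real.exp_pos _).le (sub_nonneg.2 (hS y ⟨ha.trans_lt hy.1, hy.2⟩))
  have hcont : ContinuousOn
      (fun y => Real.sinh y * (Real.exp (-(ν * u y)) * Real.sin (ν * φ y))) (Icc 0 b) := by
    fun_prop
  have hend : 0 ≤ Real.cosh b * (Real.exp (-((ν - 2) * u b)) * (1 - Real.cos (ν * φ b)))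
      / (ν * C) := by
    have hcos := sub_nonneg.2 (Real.cos_le_one (ν * φ b))
    positivity
  have hsin : κ * (φ a - 1 / ν) ≤ κ * (φ a - Real.sin (ν * φ a) / ν) := by
    gcongr
    exact Real.sin_le_one _
  rw [← intervalIntegral.integral_add_adjacent_intervals
    ((hcont.mono hsub_left).intervalIntegrable_of_Icc ha)
    ((hcont.mono hsub_right).intervalIntegrable_of_Icc hab)]
  simp only [polarMinorant, hφ0, mul_zero, Real.cos_zero, sub_self, zero_div, Real.sin_zero,
    zero_mul, add_zero, sub_zero] at hleft hright
  linarith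

end Oscillation

theorem arg_haagerupEdge_zero : (haagerupEdge 0).arg = 0 := by
  have hzero : haagerupEdge 0 = haagerupLift (π / 2 : ℝ) := by simp [haagerupEdge]
  have habs : |π / 2| ≤ π / 2 := (abs_of_pos Real.pi_div_two_pos).le
  rw [Complex.arg_eq_zero_iff, hzero]
  exact ⟨(re_haagerupLift_ofReal_pos Real.pi_div_two_pos le_rfl).le, im_haagerupLift_ofReal habs⟩

section EdgeBounds

variable {y : ℝ}

theorem one_le_norm_haagerupEdge (hy : 0 < y) : 1 ≤ ‖haagerupEdge y‖ := by
  have hE := one_le_ellipticE (one_div_cosh_sq_mem_Ioo hy.ne').2.le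
  have hsq := sq_norm_haagerupEdge hy
  exact (one_le_sq_iff₀ (norm_nonneg _)).1 (by nlinarith)

theorem sq_norm_haagerupEdge_le (hy : 0 < y) :
    ‖haagerupEdge y‖ ^ 2
      ≤ 5 / 2 + y * edgeRadialSpeed (1 / Real.cosh y ^ 2) := by
  have hm := one_div_cosh_sq_mem_Ioo hy.ne'
  have hJ := ellipticKSubE_nonneg (sub_nonneg.2 hm.2.le) (sub_lt_self 1 hm.1)
  rw [sq_norm_haagerupEdge hy, sq (ellipticKSubE _)]
  exact add_le_add (sq_ellipticE_le hm)
    (mul_le_mul (ellipticKSubE_one_sub_one_div_cosh_sq_le hy)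
      (ellipticKSubE_one_sub_le_edgeRadialSpeed hm) hJ hy.le)

theorem norm_haagerupEdge_le_two (hy : 0 < y) (hy1 : y ≤ 1) : ‖haagerupEdge y‖ ≤ 2 := by
  have hm := one_div_cosh_sq_mem_Ioo hy.ne'
  have hJ := ellipticKSubE_nonneg (sub_nonneg.2 hm.2.le) (sub_lt_self 1 hm.1)
  have hJ1 := (ellipticKSubE_one_sub_one_div_cosh_sq_le hy).trans hy1
  refine (sq_le_sq₀ (norm_nonneg _) zero_le_two).1 ?_
  rw [sq_norm_haagerupEdge hy]
  linarith [sq_ellipticE_le hm, pow_le_one₀ (n := 2) hJ hJ1]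

theorem le_arg_haagerupEdge_one : 19 / 100 ≤ (haagerupEdge 1).arg := by
  have him : (haagerupEdge 1).im = ellipticKSubE (1 - 1 / Real.cosh 1 ^ 2) := by
    simp [haagerupEdge_eq one_pos]
  have hm := one_div_cosh_sq_mem_Ioo one_ne_zero
  have hnonneg : 0 ≤ (haagerupEdge 1).arg := by
    rw [Complex.arg_nonneg_iff, him]
    exact ellipticKSubE_nonneg (sub_nonneg.2 hm.2.le) (sub_lt_self 1 hm.1)
  have hm_le : 1 / Real.cosh 1 ^ 2 ≤ 1 / 2 := by
    have hsinh : (1 : ℝ) ≤ Real.sinh 1 := Real.self_le_sinh_iff.2 zero_le_one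
    rw [Real.cosh_sq]
    exact one_div_le_one_div_of_le two_pos (by nlinarith)
  have hlower : 38 / 100 ≤ (haagerupEdge 1).im := by
    rw [him]
    nlinarith [le_ellipticKSubE (sub_nonneg.2 hm.2.le) (sub_lt_self 1 hm.1), Real.pi_gt_d2]
  have hsin : 19 / 100 ≤ Real.sin (haagerupEdge 1).arg := by
    rw [Complex.sin_arg, le_div_iff₀ (one_pos.trans_le (one_le_norm_haagerupEdge one_pos))]
    linarith [norm_haagerupEdge_le_two one_pos le_rfl]
  exact hsin.trans (Real.sin_le hnonneg)

theorem sq_norm_haagerupEdge_le_mul_edgeRadialSpeed {ν : ℝ} (hν : 21 ≤ ν) (hy : 0 < y)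
    (hy4 : y ≤ 4) :
    ‖haagerupEdge y‖ ^ 2 ≤ (ν - 2) * edgeRadialSpeed (1 / Real.cosh y ^ 2) := by
  have hspeed := pi_div_four_le_edgeRadialSpeed (one_div_cosh_sq_mem_Ioo hy.ne')
  nlinarith [sq_norm_haagerupEdge_le hy, Real.pi_gt_three]

theorem le_exp_mul_edgeRadialSpeed_sub {ν : ℝ} (hν : 21 ≤ ν) (hy : 0 < y) (hy1 : y ≤ 1) :
    Real.exp (-(ν * Real.log 2)) / 5 * ν * (π / 2) ^ 2
      ≤ Real.exp (-((ν - 2) * Real.log ‖haagerupEdge y‖))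
        * ((ν - 2) * edgeRadialSpeed (1 / Real.cosh y ^ 2) - ‖haagerupEdge y‖ ^ 2) := by
  have hspeed := pi_div_four_le_edgeRadialSpeed (one_div_cosh_sq_mem_Ioo hy.ne')
  have hnorm_pos := one_pos.trans_le (one_le_norm_haagerupEdge hy)
  have hlog : (ν - 2) * Real.log ‖haagerupEdge y‖ ≤ ν * Real.log 2 :=
    mul_le_mul (by linarith) (Real.log_le_log hnorm_pos (norm_haagerupEdge_le_two hy hy1))
      (Real.log_nonneg (one_le_norm_haagerupEdge hy)) (by linarith)
  have hpi_sq : (π / 2) ^ 2 ≤ 5 / 2 := by nlinarith [Real.pi_lt_d2, Real.pi_pos]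
  have hgap : ν / 2 ≤ (ν - 2) * edgeRadialSpeed (1 / Real.cosh y ^ 2) - ‖haagerupEdge y‖ ^ 2 := by
    have hsq := pow_le_pow_left₀ (norm_nonneg _) (norm_haagerupEdge_le_two hy hy1) 2
    nlinarith [Real.pi_gt_d2]
  calc Real.exp (-(ν * Real.log 2)) / 5 * ν * (π / 2) ^ 2
      ≤ Real.exp (-(ν * Real.log 2)) / 5 * ν * (5 / 2) := by gcongr
    _ = Real.exp (-(ν * Real.log 2)) * (ν / 2) := by ring
    _ ≤ _ := by gcongr

end EdgeBounds

theorem im_inv_pow_eq_exp_mul_sin {w : ℂ} (hw : w ≠ 0) (n : ℕ) :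
    ((w ^ n)⁻¹).im = -(Real.exp (-(n * Real.log ‖w‖)) * Real.sin (n * w.arg)) := by
  have hexp : (w ^ n)⁻¹ = Complex.exp (-(n * Complex.log w)) := by
    rw [Complex.exp_neg, Complex.exp_nat_mul, Complex.exp_log hw]
  rw [hexp, Complex.exp_im]
  simp [Complex.log_re, Complex.log_im]

theorem im_integral_sinh_mul_inv_pow_haagerupEdge (n : ℕ) (a b : ℝ) :
    (∫ y in a..b, (Real.sinh y : ℂ) * (haagerupEdge y ^ n)⁻¹).im
      = -∫ y in a..b, Real.sinh y * (Real.exp (-(n * Real.log ‖haagerupEdge y‖))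
          * Real.sin (n * (haagerupEdge y).arg)) := by
  have hne (y : ℝ) : haagerupEdge y ≠ 0 := Complex.slitPlane_ne_zero (haagerupEdge_mem_slitPlane y)
  have hcont : Continuous fun y => (Real.sinh y : ℂ) * (haagerupEdge y ^ n)⁻¹ :=
    (Complex.continuous_ofReal.comp Real.continuous_sinh).mul
      ((continuous_haagerupEdge.pow n).inv₀ fun y => pow_ne_zero n (hne y))
  rw [← intervalIntegral.integral_neg]
  refine ((Complex.imCLM.intervalIntegral_comp_comm (hcont.intervalIntegrable a b)).symm).trans
    (intervalIntegral.integral_congr fun y _ => ?_)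
  simp only [Complex.imCLM_apply]
  rw [Complex.im_ofReal_mul, im_inv_pow_eq_exp_mul_sin (hne y), mul_neg]

theorem im_integral_sinh_mul_inv_pow_haagerupEdge_le {n : ℕ} (hn : 21 ≤ n) :
    (∫ y in (0 : ℝ)..4, (Real.sinh y : ℂ) * (haagerupEdge y ^ n)⁻¹).im ≤ -(45 * (3 ^ n)⁻¹) := by
  have hn' : (21 : ℝ) ≤ n := by exact_mod_cast hn
  have hne (y : ℝ) : haagerupEdge y ≠ 0 := Complex.slitPlane_ne_zero (haagerupEdge_mem_slitPlane y)
  have hexp (y : ℝ) : Real.exp (Real.log ‖haagerupEdge y‖) = ‖haagerupEdge y‖ :=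
    Real.exp_log (norm_pos_iff.2 (hne y))
  have hlower := le_integral_sinh_mul_exp_mul_sin (ν := n) (C := π / 2)
    (κ := Real.exp (-(n * Real.log 2)) / 5) (u := fun y => Real.log ‖haagerupEdge y‖)
    (φ := fun y => (haagerupEdge y).arg) (S := fun y => edgeRadialSpeed (1 / Real.cosh y ^ 2))
    (a := 1) (b := 4) zero_le_one (by norm_num) (by linarith) (by positivity) (by positivity)
    (continuous_haagerupEdge.norm.log fun y => norm_ne_zero_iff.2 (hne y)).continuousOn
    (continuous_iff_continuousAt.2 fun y => (Complex.continuousAt_arg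
      (haagerupEdge_mem_slitPlane y)).comp continuous_haagerupEdge.continuousAt).continuousOn
    arg_haagerupEdge_zero
    (fun y hy => by simpa only [hexp] using hasDerivAt_log_norm_haagerupEdge hy.1)
    (fun y hy => by simpa only [hexp] using hasDerivAt_arg_haagerupEdge hy.1)
    (fun y hy => by
      simpa only [hexp] using sq_norm_haagerupEdge_le_mul_edgeRadialSpeed hn' hy.1 hy.2.le)
    (fun y hy => by simpa only [hexp] using le_exp_mul_edgeRadialSpeed_sub hn' hy.1 hy.2.le)
  have hexp_two : Real.exp (-(n * Real.log 2)) = (2 ^ n)⁻¹ := by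
    rw [Real.exp_neg, Real.exp_nat_mul, Real.exp_log two_pos]
  have hpow : (4000 : ℝ) * (3 ^ n)⁻¹ ≤ (2 ^ n)⁻¹ := by
    have hratio : (4000 : ℝ) ≤ (3 / 2) ^ n :=
      le_trans (by norm_num) (pow_le_pow_right₀ (by norm_num) hn)
    rw [div_pow, le_div_iff₀ (by positivity)] at hratio
    rwa [← div_eq_mul_inv, div_le_iff₀ (by positivity), inv_mul_eq_div,
      le_div_iff₀ (by positivity)]
  have hangle : 14 / 100 ≤ (haagerupEdge 1).arg - 1 / n := by
    have hinv : 1 / (n : ℝ) ≤ 1 / 21 := one_div_le_one_div_of_le (by norm_num) hn'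
    linarith [le_arg_haagerupEdge_one]
  rw [im_integral_sinh_mul_inv_pow_haagerupEdge, neg_le_neg_iff]
  refine le_trans ?_ hlower
  rw [hexp_two]
  have hpos : (0 : ℝ) < (3 ^ n)⁻¹ := by positivity
  nlinarith

theorem sq_sinh_im_le_sq_norm_complex_sin (z : ℂ) :
    Real.sinh z.im ^ 2 ≤ ‖Complex.sin z‖ ^ 2 := by
  rw [sq_norm_complex_sin, Real.sinh_sq]
  linarith [Real.cosh_two_mul z.im, Real.sinh_sq z.im, Real.cos_le_one (2 * z.re)]

theorem integral_cosh_mul_sq {y : ℝ} (hy : y ≠ 0) :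
    ∫ r in (0 : ℝ)..1, Real.cosh (r * y) ^ 2 = 1 / 2 + Real.sinh (2 * y) / (4 * y) := by
  have hderiv (r : ℝ) : HasDerivAt (fun r => r / 2 + Real.sinh (2 * y * r) / (4 * y))
      (Real.cosh (r * y) ^ 2) r := by
    refine (((hasDerivAt_id r).div_const 2).add
      ((((hasDerivAt_id r).const_mul (2 * y)).sinh).div_const (4 * y))).congr_deriv ?_
    have hdouble := Real.cosh_two_mul (r * y)
    rw [Real.sinh_sq, show 2 * (r * y) = 2 * y * r by ring] at hdouble
    simp only [id, hdouble]
    field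
  rw [intervalIntegral.integral_eq_sub_of_hasDerivAt (fun r _ => hderiv r)
    (Continuous.intervalIntegrable (by fun_prop) _ _)]
  simp

theorem norm_one_sub_haagerupLiftFactor_le {z : ℂ} (hz : |z.re| ≤ π / 2) (him : z.im ≠ 0) :
    ‖1 - haagerupLiftFactor z‖
      ≤ (1 / 2 + Real.sinh (2 * z.im) / (4 * z.im)) / Real.sinh z.im ^ 2 := by
  have hsinh : 0 < Real.sinh z.im ^ 2 := sq_pos_of_ne_zero (Real.sinh_ne_zero.2 him)
  have hpointwise (r : ℝ) :
      ‖1 - haagerupLiftIntegrand z r‖ ≤ Real.cosh (r * z.im) ^ 2 / Real.sinh z.im ^ 2 := by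
    refine (norm_one_sub_sqrt_one_sub_le _).trans ?_
    rw [norm_pow, norm_div, div_pow]
    have hcosh := norm_complex_sin_le_cosh_im (r * z)
    rw [Complex.im_ofReal_mul] at hcosh
    exact div_le_div₀ (by positivity) (pow_le_pow_left₀ (norm_nonneg _) hcosh 2) hsinh
      (sq_sinh_im_le_sq_norm_complex_sin z)
  have hint : 1 - haagerupLiftFactor z = ∫ r in (0 : ℝ)..1, (1 - haagerupLiftIntegrand z r) := by
    rw [intervalIntegral.integral_sub intervalIntegrable_const
      (intervalIntegrable_haagerupLiftIntegrand hz), haagerupLiftFactor]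
    simp
  rw [hint, ← integral_cosh_mul_sq him, ← intervalIntegral.integral_div]
  exact intervalIntegral.norm_integral_le_of_norm_le zero_le_one
    (.of_forall fun r _ => hpointwise r) (Continuous.intervalIntegrable (by fun_prop) _ _)

theorem three_le_norm_haagerupLift {z : ℂ} (hz : |z.re| ≤ π / 2) (him : z.im = 4) :
    3 ≤ ‖haagerupLift z‖ := by
  have hnorm : 4 ≤ ‖z‖ := by
    simpa only [him, abs_of_pos (zero_lt_four' ℝ)] using Complex.abs_im_le_norm z
  have hsinh : (4 : ℝ) ≤ Real.sinh 4 := Real.self_le_sinh_iff.2 (by norm_num)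
  have hfactor : ‖1 - haagerupLiftFactor z‖ ≤ 1 / 4 := by
    refine (norm_one_sub_haagerupLiftFactor_le hz (by simp [him])).trans ?_
    rw [him, div_le_iff₀ (by positivity)]
    have hdouble : Real.sinh (2 * 4) ≤ 2 * Real.sinh 4 ^ 2 + 1 := by
      linarith [Real.sinh_lt_cosh (2 * 4), Real.cosh_two_mul 4, Real.cosh_sq 4]
    have hsq : 4 ^ 2 ≤ Real.sinh 4 ^ 2 := pow_le_pow_left₀ zero_le_four hsinh 2
    generalize Real.sinh (2 * 4) = y at hdouble ⊢
    linarith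
  have hfactor' : 3 / 4 ≤ ‖haagerupLiftFactor z‖ := by
    have hsub := norm_sub_norm_le 1 (1 - haagerupLiftFactor z)
    rw [sub_sub_cancel, norm_one] at hsub
    linarith
  rw [haagerupLift, norm_mul]
  nlinarith

theorem norm_complex_cos_le_cosh_im (z : ℂ) : ‖Complex.cos z‖ ≤ Real.cosh z.im := by
  have him : (z + (π / 2 : ℝ) : ℂ).im = z.im := by simp
  rw [← Complex.sin_add_pi_div_two, ← him, Complex.ofReal_div, Complex.ofReal_ofNat]
  exact norm_complex_sin_le_cosh_im _

theorem cosh_four_le : Real.cosh 4 ≤ 28 := by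
  have hexp : Real.exp 4 ≤ 55 := by
    have hpow := pow_le_pow_left₀ (Real.exp_pos 1).le Real.exp_one_lt_d9.le 4
    rw [← Real.exp_nat_mul] at hpow
    norm_num at hpow
    linarith
  have hexp_neg : Real.exp (-4) ≤ 1 := Real.exp_le_one_iff.2 (by norm_num)
  rw [Real.cosh_eq]
  linarith

theorem norm_integral_cos_mul_inv_pow_haagerupLift_le (n : ℕ) :
    ‖∫ s in (0 : ℝ)..(π / 2), Complex.cos (s + (4 : ℝ) * I)
      * (haagerupLift (s + (4 : ℝ) * I) ^ n)⁻¹‖ ≤ 45 * (3 ^ n)⁻¹ := by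
  have hbound : ∀ s ∈ uIoc 0 (π / 2), ‖Complex.cos (s + (4 : ℝ) * I)
      * (haagerupLift (s + (4 : ℝ) * I) ^ n)⁻¹‖ ≤ 28 * (3 ^ n)⁻¹ := by
    intro s hs
    rw [uIoc_of_le Real.pi_div_two_pos.le] at hs
    have hre : (s + (4 : ℝ) * I : ℂ).re = s := by simp
    have him : (s + (4 : ℝ) * I : ℂ).im = 4 := by simp
    have hlift := three_le_norm_haagerupLift (by rw [hre, abs_of_pos hs.1]; exact hs.2) him
    have hcos := (norm_complex_cos_le_cosh_im (s + (4 : ℝ) * I)).trans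
      ((congrArg Real.cosh him).trans_le cosh_four_le)
    rw [norm_mul, norm_inv, norm_pow]
    gcongr
  refine (intervalIntegral.norm_integral_le_of_norm_le_const hbound).trans ?_
  rw [sub_zero, abs_of_pos Real.pi_div_two_pos]
  have hpos : (0 : ℝ) < (3 ^ n)⁻¹ := by positivity
  nlinarith [Real.pi_lt_d4]

section Bijection

variable {v x y : ℝ}

/-- The quotient `h x / x` as a function of `v = x²`. -/
noncomputable def realHaagerupFactor (v : ℝ) : ℝ :=
  ∫ t in (0 : ℝ)..(π / 2), Real.cos t ^ 2 / √(1 - v * Real.sin t ^ 2)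

theorem realHaagerup_eq_mul (x : ℝ) : realHaagerup x = x * realHaagerupFactor (x ^ 2) := rfl

theorem realHaagerup_neg (x : ℝ) : realHaagerup (-x) = -realHaagerup x := by
  rw [realHaagerup_eq_mul, realHaagerup_eq_mul, neg_sq, neg_mul]

theorem realHaagerup_zero : realHaagerup 0 = 0 := by rw [realHaagerup_eq_mul, zero_mul]

theorem sq_cos_le_one_sub_mul_sq_sin (hv : v ≤ 1) (t : ℝ) :
    Real.cos t ^ 2 ≤ 1 - v * Real.sin t ^ 2 := by
  rw [Real.cos_sq']
  linarith [mul_le_of_le_one_left (sq_nonneg (Real.sin t)) hv]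

theorem norm_sq_cos_div_sqrt_le_one (hv : v ≤ 1) (t : ℝ) :
    ‖Real.cos t ^ 2 / √(1 - v * Real.sin t ^ 2)‖ ≤ 1 := by
  rw [Real.norm_of_nonneg (by positivity)]
  refine div_le_one_of_le₀ ?_ (Real.sqrt_nonneg _)
  calc Real.cos t ^ 2 = |Real.cos t| * |Real.cos t| := by rw [← sq, sq_abs]
    _ ≤ |Real.cos t| := mul_le_of_le_one_left (abs_nonneg _) (Real.abs_cos_le_one t)
    _ ≤ √(1 - v * Real.sin t ^ 2) := Real.abs_le_sqrt (sq_cos_le_one_sub_mul_sq_sin hv t)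

theorem aestronglyMeasurable_sq_cos_div_sqrt (v : ℝ) (μ : MeasureTheory.Measure ℝ) :
    MeasureTheory.AEStronglyMeasurable
      (fun t => Real.cos t ^ 2 / √(1 - v * Real.sin t ^ 2)) μ :=
  Measurable.aestronglyMeasurable (by fun_prop)

theorem intervalIntegrable_sq_cos_div_sqrt (hv : v ≤ 1) (a b : ℝ) :
    IntervalIntegrable (fun t => Real.cos t ^ 2 / √(1 - v * Real.sin t ^ 2))
      MeasureTheory.volume a b :=
  (intervalIntegrable_const (c := (1 : ℝ))).mono_fun' (aestronglyMeasurable_sq_cos_div_sqrt v _)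
    (.of_forall (norm_sq_cos_div_sqrt_le_one hv))

theorem continuousOn_realHaagerupFactor : ContinuousOn realHaagerupFactor (Iic 1) := by
  intro v hv
  refine intervalIntegral.continuousWithinAt_of_dominated_interval (bound := fun _ => (1 : ℝ))
    (.of_forall fun w => aestronglyMeasurable_sq_cos_div_sqrt w _) ?_ intervalIntegrable_const ?_
  · filter_upwards [self_mem_nhdsWithin] with w hw using
      .of_forall fun t _ => norm_sq_cos_div_sqrt_le_one hw t
  · filter_upwards [ae_mem_uIoc_imp_mem_Ioo Real.pi_div_two_pos.le] with t hmem ht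
    have hcos : 0 < Real.cos t :=
      Real.cos_pos_of_mem_Ioo ⟨by linarith [(hmem ht).1, Real.pi_pos], (hmem ht).2⟩
    have hpos : 0 < 1 - v * Real.sin t ^ 2 :=
      (pow_pos hcos 2).trans_le (sq_cos_le_one_sub_mul_sq_sin hv t)
    have hcont : ContinuousAt (fun w : ℝ => Real.cos t ^ 2 / √(1 - w * Real.sin t ^ 2)) v :=
      continuousAt_const.div (by fun_prop) (Real.sqrt_pos.2 hpos).ne'
    exact hcont.continuousWithinAt

theorem sq_le_one_of_mem_Icc (hx : x ∈ Icc (-1) 1) : x ^ 2 ≤ 1 :=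
  (sq_le_one_iff_abs_le_one x).2 (abs_le.2 hx)

theorem continuousOn_realHaagerup : ContinuousOn realHaagerup (Icc (-1) 1) :=
  continuousOn_id.mul (continuousOn_realHaagerupFactor.comp (f := fun x : ℝ => x ^ 2)
    (by fun_prop) fun _ => sq_le_one_of_mem_Icc)

theorem monotoneOn_realHaagerupFactor : MonotoneOn realHaagerupFactor (Iic 1) := by
  intro v hv w hw hvw
  refine intervalIntegral.integral_mono_on Real.pi_div_two_pos.le
    (intervalIntegrable_sq_cos_div_sqrt hv _ _)
    (intervalIntegrable_sq_cos_div_sqrt hw _ _) fun t _ => ?_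
  rcases (sq_nonneg (Real.cos t)).eq_or_lt with hcos | hcos
  · simp [← hcos]
  · have hpos := hcos.trans_le (sq_cos_le_one_sub_mul_sq_sin hw t)
    refine div_le_div_of_nonneg_left hcos.le (Real.sqrt_pos.2 hpos) (Real.sqrt_le_sqrt ?_)
    gcongr

theorem realHaagerupFactor_zero : realHaagerupFactor 0 = π / 4 := by
  have hcos : ∫ t in (0 : ℝ)..(π / 2), Real.cos t ^ 2 = π / 4 := by
    rw [integral_cos_sq, Real.sin_zero, Real.cos_pi_div_two]
    ring
  simpa [realHaagerupFactor] using hcos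

theorem pi_div_four_le_realHaagerupFactor (hv : v ∈ Icc 0 1) : π / 4 ≤ realHaagerupFactor v := by
  rw [← realHaagerupFactor_zero]
  exact monotoneOn_realHaagerupFactor (mem_Iic.2 zero_le_one) hv.2 hv.1

theorem realHaagerup_one : realHaagerup 1 = 1 := by
  have hcos : ∀ t ∈ uIcc 0 (π / 2),
      Real.cos t ^ 2 / √(1 - 1 ^ 2 * Real.sin t ^ 2) = Real.cos t := by
    intro t ht
    rw [uIcc_of_le Real.pi_div_two_pos.le] at ht
    rw [one_pow, one_mul, ← Real.cos_sq', Real.sqrt_sq (Real.cos_nonneg_of_mem_Icc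
      ⟨by linarith [ht.1, Real.pi_pos], ht.2⟩), sq, mul_self_div_self]
  rw [realHaagerup, intervalIntegral.integral_congr hcos]
  simp

theorem strictMonoOn_realHaagerup_Icc_zero_one : StrictMonoOn realHaagerup (Icc 0 1) := by
  intro x hx y hy hxy
  have hsq {z : ℝ} (hz : z ∈ Icc (0 : ℝ) 1) : z ^ 2 ∈ Icc (0 : ℝ) 1 :=
    ⟨sq_nonneg z, pow_le_one₀ hz.1 hz.2⟩
  have hpos : 0 < realHaagerupFactor (y ^ 2) :=
    (by positivity : 0 < π / 4).trans_le (pi_div_four_le_realHaagerupFactor (hsq hy))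
  have hle : realHaagerupFactor (x ^ 2) ≤ realHaagerupFactor (y ^ 2) :=
    monotoneOn_realHaagerupFactor (hsq hx).2 (hsq hy).2 (pow_le_pow_left₀ hx.1 hxy.le 2)
  calc realHaagerup x = x * realHaagerupFactor (x ^ 2) := rfl
    _ ≤ x * realHaagerupFactor (y ^ 2) := mul_le_mul_of_nonneg_left hle hx.1
    _ < y * realHaagerupFactor (y ^ 2) := mul_lt_mul_of_pos_right hxy hpos

theorem strictMonoOn_realHaagerup : StrictMonoOn realHaagerup (Icc (-1) 1) := by
  have hneg : StrictMonoOn realHaagerup (Icc (-1) 0) := fun x hx y hy hxy => by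
    rw [← neg_lt_neg_iff, ← realHaagerup_neg, ← realHaagerup_neg]
    exact strictMonoOn_realHaagerup_Icc_zero_one ⟨by linarith [hy.2], by linarith [hy.1]⟩
      ⟨by linarith [hx.2], by linarith [hx.1]⟩ (neg_lt_neg hxy)
  rw [← Icc_union_Icc_eq_Icc (neg_nonpos.2 zero_le_one) zero_le_one]
  exact hneg.union strictMonoOn_realHaagerup_Icc_zero_one (isGreatest_Icc (by norm_num))
    (isLeast_Icc zero_le_one)

theorem bijOn_realHaagerup : BijOn realHaagerup (Icc (-1) 1) (Icc (-1) 1) := by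
  have hneg_one : realHaagerup (-1) = -1 := by rw [realHaagerup_neg, realHaagerup_one]
  have hmono := strictMonoOn_realHaagerup.monotoneOn
  have hle : (-1 : ℝ) ≤ 1 := by norm_num
  refine ⟨fun x hx => ⟨?_, ?_⟩, strictMonoOn_realHaagerup.injOn, ?_⟩
  · exact hneg_one.symm.trans_le (hmono (left_mem_Icc.2 hle) hx hx.1)
  · exact (hmono hx (right_mem_Icc.2 hle) hx.2).trans_eq realHaagerup_one
  · simpa only [hneg_one, realHaagerup_one, SurjOn] using
      intermediate_value_Icc hle continuousOn_realHaagerup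

theorem realHaagerupInv_realHaagerup (hx : x ∈ Icc (-1) 1) :
    realHaagerupInv (realHaagerup x) = x :=
  bijOn_realHaagerup.injOn.leftInvOn_invFunOn hx

theorem realHaagerup_realHaagerupInv (hy : y ∈ Icc (-1) 1) :
    realHaagerup (realHaagerupInv y) = y :=
  bijOn_realHaagerup.surjOn.rightInvOn_invFunOn hy

theorem realHaagerupInv_mem_Icc (hy : y ∈ Icc (-1) 1) : realHaagerupInv y ∈ Icc (-1) 1 :=
  bijOn_realHaagerup.surjOn.mapsTo_invFunOn hy

theorem realHaagerupInv_neg (hy : y ∈ Icc (-1) 1) :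
    realHaagerupInv (-y) = -realHaagerupInv y := by
  obtain ⟨hl, hr⟩ := realHaagerupInv_mem_Icc hy
  have hleft := realHaagerupInv_realHaagerup (x := -realHaagerupInv y)
    ⟨neg_le_neg hr, neg_le.2 hl⟩
  rwa [realHaagerup_neg, realHaagerup_realHaagerupInv hy] at hleft

theorem pi_div_four_mul_abs_le_abs_realHaagerup (hx : x ∈ Icc (-1) 1) :
    π / 4 * |x| ≤ |realHaagerup x| := by
  rw [realHaagerup_eq_mul, abs_mul, mul_comm]
  gcongr
  exact (pi_div_four_le_realHaagerupFactor ⟨sq_nonneg x, sq_le_one_of_mem_Icc hx⟩).trans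
    (le_abs_self _)

end Bijection

theorem haagerupLift_ofReal_eq_realHaagerup_of_abs_lt {s : ℝ} (hs : |s| < π / 2) :
    haagerupLift s = realHaagerup (Real.sin s) := by
  rcases lt_trichotomy s 0 with hneg | rfl | hpos
  · rw [abs_of_neg hneg] at hs
    rw [← neg_inj, ← haagerupLift_neg, ← Complex.ofReal_neg, ← Complex.ofReal_neg,
      ← realHaagerup_neg, ← Real.sin_neg]
    exact haagerupLift_ofReal_eq_realHaagerup (neg_pos.2 hneg) hs
  · rw [Complex.ofReal_zero, haagerupLift_zero, Real.sin_zero, realHaagerup_zero,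
      Complex.ofReal_zero]
  · exact haagerupLift_ofReal_eq_realHaagerup hpos (by rwa [abs_of_pos hpos] at hs)

theorem exists_analyticAt_hasSum_of_summable {𝕜 : Type*} [NontriviallyNormedField 𝕜]
    [CompleteSpace 𝕜] {c : ℕ → 𝕜} {x : 𝕜} (hx : x ≠ 0) (h : Summable fun j => c j * x ^ j) :
    ∃ g : 𝕜 → 𝕜, AnalyticAt 𝕜 g 0 ∧ ∀ᶠ w in 𝓝 0, HasSum (fun j => c j * w ^ j) (g w) := by
  set p := FormalMultilinearSeries.ofScalars 𝕜 c
  have hterm (j : ℕ) : ‖p j‖ * (‖x‖₊ : ℝ) ^ j = ‖c j * x ^ j‖ := by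
    rw [FormalMultilinearSeries.ofScalars_norm, coe_nnnorm, norm_mul, norm_pow]
  have hradius : (‖x‖₊ : ENNReal) ≤ p.radius :=
    p.le_radius_of_tendsto (by simpa only [hterm] using h.tendsto_atTop_zero.norm)
  have hpos : 0 < p.radius := lt_of_lt_of_le (by simpa using hx) hradius
  have hp := (p.hasFPowerSeriesOnBall hpos).hasFPowerSeriesAt
  refine ⟨p.sum, hp.analyticAt, ?_⟩
  simpa [p, mul_comm] using hasFPowerSeriesAt_iff.1 hp

theorem summable_shift_mul_pow {𝕜 : Type*} [NormedField 𝕜] {c : ℕ → 𝕜} {x : 𝕜} (hx : x ≠ 0)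
    (h : Summable fun j => c j * x ^ j) (n : ℕ) : Summable fun j => c (j + n) * x ^ j := by
  refine (((summable_nat_add_iff n).2 h).mul_right (x ^ n)⁻¹).congr fun j => ?_
  rw [pow_add, mul_assoc, mul_assoc, mul_inv_cancel₀ (pow_ne_zero n hx), mul_one]

section Expansion

variable {b : ℕ → ℝ}

theorem IsHaagerupInvExpansion.exists_summable (hb : IsHaagerupInvExpansion b) :
    ∃ x : ℝ, x ≠ 0 ∧ Summable fun j => b j * x ^ j := by
  obtain ⟨t, hsum, ht⟩ := ((hb.filter_mono nhdsWithin_le_nhds).and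
    (self_mem_nhdsWithin : {0}ᶜ ∈ 𝓝[≠] (0 : ℝ))).exists
  refine ⟨t ^ 2, pow_ne_zero 2 ht, (hsum.summable.mul_right t⁻¹).congr fun j => ?_⟩
  rw [pow_succ, ← pow_mul, ← mul_assoc, mul_inv_cancel_right₀ ht]

theorem tendsto_ofReal_nhdsNE_zero :
    Tendsto (fun s : ℝ => (s : ℂ)) (𝓝[≠] 0) (𝓝[≠] 0) := by
  refine tendsto_nhdsWithin_iff.2 ⟨?_, ?_⟩
  · simpa using (Complex.continuous_ofReal.tendsto 0).mono_left nhdsWithin_le_nhds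
  · filter_upwards [self_mem_nhdsWithin] with s hs using Complex.ofReal_ne_zero.2 hs

theorem analyticAt_haagerupLift_zero : AnalyticAt ℂ haagerupLift 0 :=
  analyticAt_haagerupLift (by simpa using Real.pi_div_two_pos)

theorem tendsto_haagerupLift_zero : Tendsto haagerupLift (𝓝 0) (𝓝 0) := by
  simpa using analyticAt_haagerupLift_zero.continuousAt.tendsto

theorem IsHaagerupInvExpansion.eventually_hasSum_haagerupLift_ofReal
    (hb : IsHaagerupInvExpansion b) : ∀ᶠ s : ℝ in 𝓝 0,
      HasSum (fun j => (b j : ℂ) * haagerupLift s ^ (2 * j + 1)) (Complex.sin s) := by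
  have hlift : Tendsto (fun s : ℝ => (haagerupLift s).re) (𝓝 0) (𝓝 0) :=
    (Complex.continuous_re.tendsto' 0 0 rfl).comp <| tendsto_haagerupLift_zero.comp <|
      Complex.continuous_ofReal.tendsto' 0 0 rfl
  have hsmall : ∀ᶠ s : ℝ in 𝓝 0, |s| < π / 2 :=
    continuous_abs.continuousAt.eventually_lt_const (by simpa using Real.pi_div_two_pos)
  filter_upwards [hsmall, hlift.eventually hb] with s hs hsum
  have hsin : Real.sin s ∈ Icc (-1 : ℝ) 1 := ⟨Real.neg_one_le_sin s, Real.sin_le_one s⟩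
  rw [haagerupLift_ofReal_eq_realHaagerup_of_abs_lt hs] at hsum ⊢
  rw [Complex.ofReal_re, realHaagerupInv_realHaagerup hsin] at hsum
  exact_mod_cast hsum

/-- The remainder of the expansion of `sin z = h⁻¹ (haagerupLift z)` after `n` terms. -/
noncomputable def haagerupRemainder (b : ℕ → ℝ) (n : ℕ) (z : ℂ) : ℂ :=
  Complex.sin z - ∑ j ∈ Finset.range n, (b j : ℂ) * haagerupLift z ^ (2 * j + 1)

theorem analyticAt_haagerupRemainder (b : ℕ → ℝ) (n : ℕ) {z : ℂ} (hz : |z.re| < π / 2) :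
    AnalyticAt ℂ (haagerupRemainder b n) z :=
  Complex.analyticAt_sin.sub <| Finset.analyticAt_fun_sum _ fun _ _ =>
    analyticAt_const.mul ((analyticAt_haagerupLift hz).pow _)

theorem IsHaagerupInvExpansion.exists_haagerupRemainder_eventuallyEq
    (hb : IsHaagerupInvExpansion b) (n : ℕ) : ∃ r : ℂ → ℂ, AnalyticAt ℂ r 0 ∧
      haagerupRemainder b n =ᶠ[𝓝 0] fun z => haagerupLift z ^ (2 * n + 1) * r z := by
  obtain ⟨x, hx, hsummable⟩ := hb.exists_summable
  obtain ⟨g, hg, hsum⟩ := exists_analyticAt_hasSum_of_summable (c := fun j => (b (j + n) : ℂ))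
    (Complex.ofReal_ne_zero.2 hx) (by exact_mod_cast summable_shift_mul_pow hx hsummable n)
  have hr : AnalyticAt ℂ (fun z => g (haagerupLift z ^ 2)) 0 :=
    AnalyticAt.fun_comp (by simpa using hg) (analyticAt_haagerupLift_zero.pow 2)
  refine ⟨fun z => g (haagerupLift z ^ 2), hr, ?_⟩
  have hsq : Tendsto (fun s : ℝ => haagerupLift s ^ 2) (𝓝 0) (𝓝 0) := by
    simpa using (tendsto_haagerupLift_zero.comp
      (Complex.continuous_ofReal.tendsto' 0 0 rfl)).pow 2
  have hreal : ∀ᶠ s : ℝ in 𝓝 0,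
      haagerupRemainder b n s = haagerupLift s ^ (2 * n + 1) * g (haagerupLift s ^ 2) := by
    filter_upwards [hb.eventually_hasSum_haagerupLift_ofReal, hsq.eventually hsum] with s hs hgs
    refine ((hasSum_nat_add_iff' n).2 hs).unique ((hgs.mul_left _).congr_fun fun j => ?_)
    ring
  exact ((analyticAt_haagerupRemainder b n (by simpa using Real.pi_div_two_pos)
    ).frequently_eq_iff_eventually_eq ((analyticAt_haagerupLift_zero.pow _).mul hr)).1
    (tendsto_ofReal_nhdsNE_zero.frequently (hreal.filter_mono nhdsWithin_le_nhds).frequently)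

end Expansion

section RealityOnAxes

variable {f : ℂ → ℂ}

theorem im_deriv_ofReal_eq_zero {x : ℝ} (hf : DifferentiableAt ℂ f x)
    (hreal : ∀ᶠ t : ℝ in 𝓝 x, (f t).im = 0) : (deriv f x).im = 0 :=
  (Complex.imCLM.hasFDerivAt.comp_hasDerivAt x hf.hasDerivAt.comp_ofReal).unique
    ((hasDerivAt_const x (0 : ℝ)).congr_of_eventuallyEq hreal)

theorem im_deriv_mul_I_eq_zero {y : ℝ} (hf : DifferentiableAt ℂ f (y * I))
    (himag : ∀ᶠ t : ℝ in 𝓝 y, (f (t * I)).re = 0) : (deriv f (y * I)).im = 0 := by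
  have hline : HasDerivAt (fun t : ℝ => (t : ℂ) * I) I y := by
    simpa using (Complex.ofRealCLM.hasDerivAt (x := y)).mul_const I
  simpa using (Complex.reCLM.hasFDerivAt.comp_hasDerivAt y (hf.hasDerivAt.comp y hline)).unique
    ((hasDerivAt_const y (0 : ℝ)).congr_of_eventuallyEq himag)

theorem im_intervalIntegral_eq_zero {g : ℝ → ℂ} {p q : ℝ} (hg : ∀ x ∈ uIcc p q, (g x).im = 0) :
    (∫ x in p..q, g x).im = 0 := by
  have hre : ∀ x ∈ uIcc p q, g x = ((g x).re : ℂ) := fun x hx => Complex.ext rfl (hg x hx)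
  rw [intervalIntegral.integral_congr hre, intervalIntegral.integral_ofReal, Complex.ofReal_im]

theorem im_integral_boundary_rect_of_im_eq_zero {a c Y : ℝ}
    (hcont : ContinuousOn f (uIcc a c ×ℂ uIcc 0 Y))
    (hdiff : DifferentiableOn ℂ f
      (Ioo (min a c) (max a c) ×ℂ Ioo (min 0 Y) (max 0 Y)))
    (hreal : ∀ x ∈ uIcc a c, (f x).im = 0) :
    (I * ∫ y in 0..Y, f (c + y * I)).im - (∫ x in a..c, f (x + Y * I)).im
      = (I * ∫ y in 0..Y, f (a + y * I)).im := by
  have hrect := Complex.integral_boundary_rect_eq_zero_of_continuousOn_of_differentiableOn f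
    a (c + Y * I) (by simpa using hcont) (by simpa using hdiff)
  simp only [Complex.ofReal_re, Complex.ofReal_im, Complex.add_re, Complex.add_im,
    Complex.re_ofReal_mul, Complex.im_ofReal_mul, Complex.I_re, Complex.I_im, mul_zero, mul_one,
    add_zero, zero_add, Complex.ofReal_zero, zero_mul, smul_eq_mul] at hrect
  have him := congrArg Complex.im hrect
  rw [Complex.sub_im, Complex.add_im, Complex.sub_im, im_intervalIntegral_eq_zero hreal,
    Complex.zero_im] at him
  linarith

theorem im_zpow_two_mul_eq_zero {w : ℂ} (hw : (w ^ 2).im = 0) (m : ℤ) :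
    (w ^ (2 * m)).im = 0 := by
  obtain ⟨x, hx⟩ : ∃ x : ℝ, (x : ℂ) = w ^ 2 := CanLift.prf _ hw
  rw [zpow_mul, zpow_ofNat, ← hx, ← Complex.ofReal_zpow, Complex.ofReal_im]

theorem re_pow_two_mul_add_one_eq_zero {w : ℂ} (hw : w.re = 0) (m : ℕ) :
    (w ^ (2 * m + 1)).re = 0 := by
  have heven : (w ^ (2 * m)).im = 0 := by
    exact_mod_cast im_zpow_two_mul_eq_zero (by simp [sq, hw]) (m : ℤ)
  rw [pow_succ, Complex.mul_re, hw, heven, mul_zero, zero_mul, sub_zero]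

end RealityOnAxes

section Contour

variable {b : ℕ → ℝ} {n k : ℕ} {z : ℂ}

theorem im_haagerupRemainder_ofReal {s : ℝ} (hs : |s| ≤ π / 2) :
    (haagerupRemainder b n s).im = 0 := by
  obtain ⟨p, hp⟩ : ∃ p : ℝ, (p : ℂ) = haagerupLift s := CanLift.prf _ (im_haagerupLift_ofReal hs)
  rw [haagerupRemainder, ← hp]
  exact_mod_cast Complex.ofReal_im (Real.sin s - ∑ j ∈ Finset.range n, b j * p ^ (2 * j + 1))

theorem re_haagerupRemainder_mul_I (y : ℝ) : (haagerupRemainder b n (y * I)).re = 0 := by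
  have hpow (j : ℕ) := re_pow_two_mul_add_one_eq_zero (re_haagerupLift_mul_I y) j
  simp [haagerupRemainder, hpow, Complex.sin_mul_I, ← Complex.ofReal_sinh]

theorem hasDerivAt_haagerupRemainder (hz : |z.re| < π / 2) :
    HasDerivAt (haagerupRemainder b n) (Complex.cos z - ∑ j ∈ Finset.range n,
      (b j : ℂ) * ((2 * j + 1) * haagerupLift z ^ (2 * j) * deriv haagerupLift z)) z := by
  have hlift := (differentiableAt_haagerupLift hz).hasDerivAt
  refine (Complex.hasDerivAt_sin z).sub (HasDerivAt.fun_sum fun j _ => ?_)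
  simpa using (hlift.pow (2 * j + 1)).const_mul (b j : ℂ)

/-- The holomorphic function whose contour integral gives the coefficient `b k`. -/
noncomputable def contourIntegrand (b : ℕ → ℝ) (k : ℕ) (z : ℂ) : ℂ :=
  deriv (haagerupRemainder b (k + 1)) z * (haagerupLift z ^ (2 * k + 1))⁻¹

/-- A primitive of the difference between `cos z * (haagerupLift z ^ (2 * k + 1))⁻¹` and
`contourIntegrand b k z`. -/
noncomputable def contourPrimitive (b : ℕ → ℝ) (k : ℕ) (z : ℂ) : ℂ :=
  ∑ j ∈ Finset.range k, ((2 * j + 1) * b j / (2 * (j - k)) : ℝ)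
      * haagerupLift z ^ (2 * (j - k : ℤ))
    + ((2 * k + 1) * b k : ℝ) * Complex.log (haagerupLift z)

theorem hasDerivAt_contourPrimitive (hz : |z.re| < π / 2) (hz0 : z ≠ 0) (hre : 0 ≤ z.re) :
    HasDerivAt (contourPrimitive b k)
      (Complex.cos z * (haagerupLift z ^ (2 * k + 1))⁻¹ - contourIntegrand b k z) z := by
  have hlift := (differentiableAt_haagerupLift hz).hasDerivAt
  have hne := haagerupLift_ne_zero hz.le hz0
  have hlog := hlift.clog (haagerupLift_mem_slitPlane hz.le hz0 hre)
  have hzpow (j : ℕ) := ((hasDerivAt_zpow (2 * (j - k : ℤ)) _ (.inl hne)).comp z hlift).const_mul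
    (((2 * j + 1) * b j / (2 * (j - k)) : ℝ) : ℂ)
  refine ((HasDerivAt.fun_sum fun j _ => hzpow j).add (hlog.const_mul _)).congr_deriv ?_
  rw [contourIntegrand, (hasDerivAt_haagerupRemainder hz).deriv, Finset.sum_range_succ,
    sub_mul, sub_sub_cancel, add_mul (Finset.sum _ _), Finset.sum_mul]
  congr 1
  · refine Finset.sum_congr rfl fun j hj => ?_
    have hjk : (j - k : ℂ) ≠ 0 := sub_ne_zero.2 (Nat.cast_injective.ne (Finset.mem_range.1 hj).ne)
    rw [show 2 * (j - k : ℤ) - 1 = (2 * j : ℕ) - (2 * k + 1 : ℕ) by push_cast; ring,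
      zpow_sub₀ hne, zpow_natCast, zpow_natCast]
    push_cast
    field_simp
  · push_cast
    field_simp
    ring

theorem differentiableAt_contourIntegrand (hb : IsHaagerupInvExpansion b) (hz : |z.re| < π / 2) :
    DifferentiableAt ℂ (contourIntegrand b k) z := by
  rcases eq_or_ne z 0 with rfl | hz0
  · obtain ⟨r, hr, hremainder⟩ := hb.exists_haagerupRemainder_eventuallyEq (k + 1)
    have hlift := analyticAt_haagerupLift_zero
    have hfactor : contourIntegrand b k =ᶠ[𝓝 0] fun z => haagerupLift z
        * ((2 * k + 3) * deriv haagerupLift z * r z + haagerupLift z * deriv r z) := by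
      filter_upwards [hremainder.deriv, hr.eventually_analyticAt, hlift.eventually_analyticAt]
        with z hderiv hrz hliftz
      have hprod := ((hliftz.differentiableAt.hasDerivAt.pow (2 * (k + 1) + 1)).mul
        hrz.differentiableAt.hasDerivAt).deriv
      rw [contourIntegrand, hderiv]
      refine (congrArg (· * (haagerupLift z ^ (2 * k + 1))⁻¹) hprod).trans ?_
      rcases eq_or_ne (haagerupLift z) 0 with hzero | hne
      · simp [hzero]
      · simp only [Pi.pow_apply]
        push_cast
        field_simp
        ring
    exact ((hlift.mul ((analyticAt_const.mul hlift.deriv |>.mul hr).add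
      (hlift.mul hr.deriv))).congr hfactor.symm).differentiableAt
  · exact (analyticAt_haagerupRemainder b _ hz).deriv.differentiableAt.mul
      (((differentiableAt_haagerupLift hz).pow _).inv
        (pow_ne_zero _ (haagerupLift_ne_zero hz.le hz0)))

theorem im_contourIntegrand_ofReal {s : ℝ} (hs : |s| < π / 2) :
    (contourIntegrand b k s).im = 0 := by
  have hderiv : (deriv (haagerupRemainder b (k + 1)) s).im = 0 := by
    refine im_deriv_ofReal_eq_zero (analyticAt_haagerupRemainder b _ hs).differentiableAt ?_
    filter_upwards [continuous_abs.continuousAt.eventually_lt_const hs] with t ht using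
      im_haagerupRemainder_ofReal ht.le
  obtain ⟨p, hp⟩ : ∃ p : ℝ, (p : ℂ) = haagerupLift s :=
    CanLift.prf _ (im_haagerupLift_ofReal hs.le)
  rw [contourIntegrand, ← hp, ← Complex.ofReal_pow, ← Complex.ofReal_inv, Complex.im_mul_ofReal,
    hderiv, zero_mul]

theorem re_contourIntegrand_mul_I (y : ℝ) : (contourIntegrand b k (y * I)).re = 0 := by
  have hderiv : (deriv (haagerupRemainder b (k + 1)) (y * I)).im = 0 :=
    im_deriv_mul_I_eq_zero
      (analyticAt_haagerupRemainder b _ (by simpa using Real.pi_div_two_pos)).differentiableAt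
      (.of_forall re_haagerupRemainder_mul_I)
  rw [contourIntegrand, Complex.mul_re, Complex.inv_re, hderiv,
    re_pow_two_mul_add_one_eq_zero (re_haagerupLift_mul_I y), zero_div, mul_zero,
    zero_mul, sub_zero]

theorem im_contourPrimitive (hz : (haagerupLift z ^ 2).im = 0) :
    (contourPrimitive b k z).im = (2 * k + 1) * b k * (haagerupLift z).arg := by
  have hpow (j : ℕ) : (haagerupLift z ^ (2 * (j - k : ℤ))).im = 0 :=
    im_zpow_two_mul_eq_zero hz _
  simp only [contourPrimitive, Complex.add_im, Complex.im_sum, Complex.im_ofReal_mul, hpow,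
    mul_zero, Finset.sum_const_zero, zero_add, Complex.log_im]

theorem arg_haagerupLift_ofReal {s : ℝ} (hs : 0 < s) (hs' : s ≤ π / 2) :
    (haagerupLift s).arg = 0 :=
  Complex.arg_eq_zero_iff.2 ⟨(re_haagerupLift_ofReal_pos hs hs').le,
    im_haagerupLift_ofReal ((abs_of_pos hs).trans_le hs')⟩

theorem arg_haagerupLift_mul_I {y : ℝ} (hy : 0 < y) : (haagerupLift (y * I)).arg = π / 2 :=
  Complex.arg_eq_pi_div_two_iff.2 ⟨re_haagerupLift_mul_I y, im_haagerupLift_mul_I_pos hy⟩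

theorem differentiableAt_cos_mul_inv_haagerupLift_pow (hz : |z.re| < π / 2) (hz0 : z ≠ 0) :
    DifferentiableAt ℂ (fun z => Complex.cos z * (haagerupLift z ^ n)⁻¹) z :=
  Complex.differentiableAt_cos.mul (((differentiableAt_haagerupLift hz).pow n).inv
    (pow_ne_zero n (haagerupLift_ne_zero hz.le hz0)))

theorem continuousOn_cos_mul_inv_haagerupLift_pow :
    ContinuousOn (fun z => Complex.cos z * (haagerupLift z ^ n)⁻¹)
      {z : ℂ | |z.re| ≤ π / 2 ∧ z ≠ 0} :=
  Complex.continuous_cos.continuousOn.mul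
    (((continuousOn_haagerupLift.mono fun _ hz => hz.1).pow n).inv₀
      fun _ hz => pow_ne_zero n (haagerupLift_ne_zero hz.1 hz.2))

theorem im_cos_mul_inv_haagerupLift_pow_ofReal {s : ℝ} (hs : |s| ≤ π / 2) :
    (Complex.cos s * (haagerupLift s ^ n)⁻¹).im = 0 := by
  obtain ⟨p, hp⟩ : ∃ p : ℝ, (p : ℂ) = haagerupLift s := CanLift.prf _ (im_haagerupLift_ofReal hs)
  rw [← hp]
  exact_mod_cast Complex.ofReal_im (Real.cos s * (p ^ n)⁻¹)

theorem integral_contourIntegrand_eq (hb : IsHaagerupInvExpansion b) {v : ℂ} {p q : ℝ}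
    (hseg : ∀ t ∈ uIcc p q,
      |(z + t * v).re| < π / 2 ∧ z + t * v ≠ 0 ∧ 0 ≤ (z + t * v).re) :
    (∫ t in p..q, contourIntegrand b k (z + t * v)) * v
      = (∫ t in p..q, Complex.cos (z + t * v) * (haagerupLift (z + t * v) ^ (2 * k + 1))⁻¹) * v
        - (contourPrimitive b k (z + q * v) - contourPrimitive b k (z + p * v)) := by
  have hcos : ContinuousOn (fun t : ℝ => Complex.cos (z + t * v)
      * (haagerupLift (z + t * v) ^ (2 * k + 1))⁻¹) (uIcc p q) :=
    continuousOn_cos_mul_inv_haagerupLift_pow.comp (by fun_prop)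
      fun t ht => ⟨(hseg t ht).1.le, (hseg t ht).2.1⟩
  have hcontour : ContinuousOn (fun t : ℝ => contourIntegrand b k (z + t * v)) (uIcc p q) :=
    fun t ht => ((differentiableAt_contourIntegrand hb (hseg t ht).1).continuousAt.comp
      (f := fun t : ℝ => z + t * v) (by fun_prop)).continuousWithinAt
  have hprimitive := integral_comp_line_mul_eq_sub (v := v)
    (f := fun z => Complex.cos z * (haagerupLift z ^ (2 * k + 1))⁻¹ - contourIntegrand b k z)
    (fun t ht => hasDerivAt_contourPrimitive (hseg t ht).1 (hseg t ht).2.1 (hseg t ht).2.2)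
    (hcos.sub hcontour)
  rw [intervalIntegral.integral_mul_const, intervalIntegral.integral_sub
    hcos.intervalIntegrable hcontour.intervalIntegrable] at hprimitive
  rw [← hprimitive]
  ring

theorem im_integral_boundary_contourIntegrand (hb : IsHaagerupInvExpansion b) {a Y : ℝ}
    (ha : 0 ≤ a) (ha' : a < π / 2) :
    (I * ∫ y in 0..Y, contourIntegrand b k (a + y * I)).im
      = (∫ x in 0..a, contourIntegrand b k (x + Y * I)).im := by
  have hstrip {z : ℂ} (hz : z.re ∈ uIcc 0 a) : |z.re| < π / 2 := by
    rw [uIcc_of_le ha] at hz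
    exact (abs_of_nonneg hz.1).trans_lt (hz.2.trans_lt ha')
  have hdiff : DifferentiableOn ℂ (contourIntegrand b k) (uIcc 0 a ×ℂ uIcc 0 Y) := fun z hz =>
    (differentiableAt_contourIntegrand hb (hstrip hz.1)).differentiableWithinAt
  have hrect := im_integral_boundary_rect_of_im_eq_zero hdiff.continuousOn
    (hdiff.mono fun _ hz => ⟨Ioo_subset_Icc_self hz.1, Ioo_subset_Icc_self hz.2⟩)
    fun x hx => im_contourIntegrand_ofReal (hstrip (z := x) hx)
  have hleft : (I * ∫ y in 0..Y, contourIntegrand b k ((0 : ℝ) + y * I)).im = 0 := by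
    rw [← intervalIntegral.integral_const_mul]
    refine im_intervalIntegral_eq_zero fun y _ => ?_
    rw [Complex.I_mul_im, Complex.ofReal_zero, zero_add, re_contourIntegrand_mul_I]
  rwa [hleft, sub_eq_zero] at hrect

theorem coefficient_eq_im_contour_of_lt (hb : IsHaagerupInvExpansion b) {a Y : ℝ} (ha : 0 < a)
    (ha' : a < π / 2) (hY : 0 < Y) :
    (2 * k + 1) * b k * (π / 2)
      = (I * ∫ y in 0..Y, Complex.cos (a + y * I)
          * (haagerupLift (a + y * I) ^ (2 * k + 1))⁻¹).im
        - (∫ x in 0..a, Complex.cos (x + Y * I)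
          * (haagerupLift (x + Y * I) ^ (2 * k + 1))⁻¹).im := by
  have hright := integral_contourIntegrand_eq (k := k) hb (z := a) (v := I) (p := 0) (q := Y)
    fun t _ => ⟨by simpa [abs_of_pos ha] using ha',
      fun h => ha.ne' (by simpa using congrArg Complex.re h), by simpa using ha.le⟩
  have htop := integral_contourIntegrand_eq (k := k) hb (z := Y * I) (v := 1) (p := 0) (q := a)
    fun t ht => by
      rw [uIcc_of_le ha.le] at ht
      exact ⟨by simpa [abs_of_nonneg ht.1] using ht.2.trans_lt ha',
        fun h => hY.ne' (by simpa using congrArg Complex.im h), by simpa using ht.1⟩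
  simp only [mul_one, add_comm ((Y : ℂ) * I), Complex.ofReal_zero, zero_mul, add_zero,
    zero_add] at htop hright
  have hboundary := im_integral_boundary_contourIntegrand (k := k) (Y := Y) hb ha.le ha'
  have hbottom : (contourPrimitive b k a).im = 0 := by
    have hreal : (haagerupLift a).im = 0 := im_haagerupLift_ofReal ((abs_of_pos ha).trans_le ha'.le)
    rw [im_contourPrimitive (by simp [sq, hreal]), arg_haagerupLift_ofReal ha ha'.le, mul_zero]
  have hleft : (contourPrimitive b k (Y * I)).im = (2 * k + 1) * b k * (π / 2) := by
    rw [im_contourPrimitive (by simp [sq, re_haagerupLift_mul_I]), arg_haagerupLift_mul_I hY]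
  rw [mul_comm I, hright, htop] at hboundary
  simp only [Complex.sub_im, hbottom, hleft] at hboundary
  rw [mul_comm I]
  linarith

theorem im_integral_boundary_cos_mul_inv_haagerupLift_pow {a : ℝ} (Y : ℝ) (ha : 0 < a)
    (ha' : a < π / 2) :
    (I * ∫ y in 0..Y, Complex.cos ((π / 2 : ℝ) + y * I)
          * (haagerupLift ((π / 2 : ℝ) + y * I) ^ n)⁻¹).im
        - (∫ x in a..(π / 2), Complex.cos (x + Y * I) * (haagerupLift (x + Y * I) ^ n)⁻¹).im
      = (I * ∫ y in 0..Y, Complex.cos (a + y * I) * (haagerupLift (a + y * I) ^ n)⁻¹).im := by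
  have hdomain {z : ℂ} (hz : z.re ∈ uIcc a (π / 2)) : |z.re| ≤ π / 2 ∧ z ≠ 0 := by
    rw [uIcc_of_le ha'.le] at hz
    exact ⟨(abs_of_pos (ha.trans_le hz.1)).trans_le hz.2,
      fun h => (ha.trans_le hz.1).ne' (by rw [h, Complex.zero_re])⟩
  exact im_integral_boundary_rect_of_im_eq_zero
    (f := fun z => Complex.cos z * (haagerupLift z ^ n)⁻¹)
    (continuousOn_cos_mul_inv_haagerupLift_pow.mono fun z hz => hdomain hz.1)
    (fun z hz => (differentiableAt_cos_mul_inv_haagerupLift_pow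
      (abs_lt.2 ⟨by linarith [hz.1.1, min_eq_left ha'.le], hz.1.2.trans_eq (max_eq_right ha'.le)⟩)
      (hdomain (Ioo_subset_Icc_self hz.1)).2).differentiableWithinAt)
    (fun x hx => im_cos_mul_inv_haagerupLift_pow_ofReal (hdomain (z := x) hx).1)

theorem coefficient_eq_im_contour (hb : IsHaagerupInvExpansion b) {Y : ℝ} (hY : 0 < Y) :
    (2 * k + 1) * b k * (π / 2)
      = (∫ y in 0..Y, (Real.sinh y : ℂ) * (haagerupEdge y ^ (2 * k + 1))⁻¹).im
        - (∫ x in 0..(π / 2), Complex.cos (x + Y * I)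
          * (haagerupLift (x + Y * I) ^ (2 * k + 1))⁻¹).im := by
  obtain ⟨a, ha, ha'⟩ := exists_between Real.pi_div_two_pos
  have htop : ContinuousOn (fun x : ℝ => Complex.cos (x + Y * I)
      * (haagerupLift (x + Y * I) ^ (2 * k + 1))⁻¹) (Icc 0 (π / 2)) :=
    continuousOn_cos_mul_inv_haagerupLift_pow.comp (by fun_prop) fun x hx =>
      ⟨by simpa [abs_of_nonneg hx.1] using hx.2,
        fun h => hY.ne' (by simpa using congrArg Complex.im h)⟩
  have hsplit := congrArg Complex.im (intervalIntegral.integral_add_adjacent_intervals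
    (μ := MeasureTheory.volume)
    ((htop.mono (Icc_subset_Icc_right ha'.le)).intervalIntegrable_of_Icc ha.le)
    ((htop.mono (Icc_subset_Icc_left ha.le)).intervalIntegrable_of_Icc ha'.le))
  have hedge : I * ∫ y in 0..Y, Complex.cos ((π / 2 : ℝ) + y * I)
        * (haagerupLift ((π / 2 : ℝ) + y * I) ^ (2 * k + 1))⁻¹
      = ∫ y in 0..Y, (Real.sinh y : ℂ) * (haagerupEdge y ^ (2 * k + 1))⁻¹ := by
    rw [← intervalIntegral.integral_const_mul]
    refine intervalIntegral.integral_congr fun y _ => ?_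
    simp only [complex_cos_pi_div_two_add_mul_I, haagerupEdge]
    linear_combination (-(Real.sinh y : ℂ)
      * (haagerupLift ((π / 2 : ℝ) + y * I) ^ (2 * k + 1))⁻¹) * Complex.I_sq
  have hbelow := coefficient_eq_im_contour_of_lt (k := k) hb ha ha' hY
  have hrect := im_integral_boundary_cos_mul_inv_haagerupLift_pow (n := 2 * k + 1) Y ha ha'
  rw [hedge] at hrect
  rw [Complex.add_im] at hsplit
  linarith

theorem IsHaagerupInvExpansion.nonpos_of_ten_le (hb : IsHaagerupInvExpansion b) (hk : 10 ≤ k) :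
    b k ≤ 0 := by
  have hcontour := coefficient_eq_im_contour (k := k) hb (Y := 4) (by norm_num)
  have hedge := im_integral_sinh_mul_inv_pow_haagerupEdge_le (n := 2 * k + 1) (by lia)
  have htop := (abs_le.1 ((Complex.abs_im_le_norm _).trans
    (norm_integral_cos_mul_inv_pow_haagerupLift_le (2 * k + 1)))).1
  have hscaled : b k * ((2 * k + 1) * (π / 2)) ≤ 0 := by linarith
  exact nonpos_of_mul_nonpos_left hscaled (by positivity)

end Contour

section MaclaurinSeries

variable {𝕜 : Type*} [RCLike 𝕜]

/-- The formal power series `φ` converges to `f` in a neighbourhood of `0`. -/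
def IsMaclaurinSeries (φ : PowerSeries 𝕜) (f : 𝕜 → 𝕜) : Prop :=
  ∀ᶠ w in 𝓝 0, HasSum (fun n => φ.coeff n * w ^ n) (f w)

namespace IsMaclaurinSeries

variable {φ ψ : PowerSeries 𝕜} {f g : 𝕜 → 𝕜}

theorem hasFPowerSeriesAt (hf : IsMaclaurinSeries φ f) :
    HasFPowerSeriesAt f (FormalMultilinearSeries.ofScalars 𝕜 fun n => φ.coeff n) 0 :=
  hasFPowerSeriesAt_iff.2 <| hf.mono fun w hw => by simpa [mul_comm] using hw

theorem analyticAt (hf : IsMaclaurinSeries φ f) : AnalyticAt 𝕜 f 0 :=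
  hf.hasFPowerSeriesAt.analyticAt

theorem eq_of_frequently_eq (hf : IsMaclaurinSeries φ f) (hg : IsMaclaurinSeries ψ g)
    (h : ∃ᶠ w in 𝓝[≠] 0, f w = g w) : φ = ψ := by
  have hfg := (hf.analyticAt.frequently_eq_iff_eventually_eq hg.analyticAt).1 h
  have hseries := (hf.hasFPowerSeriesAt.congr hfg).eq_formalMultilinearSeries hg.hasFPowerSeriesAt
  ext n
  simpa using congrArg (fun p => p.coeff n) hseries

theorem ofPolynomial (p : Polynomial 𝕜) : IsMaclaurinSeries p fun w => p.eval w :=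
  .of_forall fun w => by
    simp only [Polynomial.coeff_coe, Polynomial.eval_eq_sum, Polynomial.sum]
    exact hasSum_sum_of_ne_finset_zero fun n hn => by
      rw [Polynomial.notMem_support_iff.1 hn, zero_mul]

theorem sub (hf : IsMaclaurinSeries φ f) (hg : IsMaclaurinSeries ψ g) :
    IsMaclaurinSeries (φ - ψ) fun w => f w - g w := by
  filter_upwards [hf, hg] with w hf hg
  simpa only [map_sub, sub_mul] using hf.sub hg

theorem sum {ι : Type*} (s : Finset ι) {φ : ι → PowerSeries 𝕜} {f : ι → 𝕜 → 𝕜}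
    (h : ∀ i ∈ s, IsMaclaurinSeries (φ i) (f i)) :
    IsMaclaurinSeries (∑ i ∈ s, φ i) fun w => ∑ i ∈ s, f i w := by
  filter_upwards [(Filter.eventually_all_finset s).2 h] with w hw
  simpa only [map_sum, Finset.sum_mul] using hasSum_sum hw

theorem mul (hf : IsMaclaurinSeries φ f) (hg : IsMaclaurinSeries ψ g) :
    IsMaclaurinSeries (φ * ψ) fun w => f w * g w := by
  filter_upwards [hf, hg] with w hf hg
  have hterm (n : ℕ) : (φ * ψ).coeff n * w ^ n = ∑ ij ∈ Finset.HasAntidiagonal.antidiagonal n,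
      (φ.coeff ij.1 * w ^ ij.1) * (ψ.coeff ij.2 * w ^ ij.2) := by
    rw [PowerSeries.coeff_mul, Finset.sum_mul]
    refine Finset.sum_congr rfl fun ij hij => ?_
    rw [← Finset.HasAntidiagonal.mem_antidiagonal.1 hij, pow_add]
    ring
  simp only [hterm]
  rw [← hf.tsum_eq, ← hg.tsum_eq,
    tsum_mul_tsum_eq_tsum_sum_antidiagonal_of_summable_norm hf.summable.norm hg.summable.norm]
  exact (summable_norm_sum_mul_antidiagonal_of_summable_norm
    hf.summable.norm hg.summable.norm).of_norm.hasSum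

theorem pow (hf : IsMaclaurinSeries φ f) (n : ℕ) :
    IsMaclaurinSeries (φ ^ n) fun w => f w ^ n := by
  induction n with
  | zero => simpa using ofPolynomial 1
  | succ n ih => simpa only [pow_succ] using ih.mul hf

end IsMaclaurinSeries

theorem exists_isMaclaurinSeries_of_analyticAt {f : 𝕜 → 𝕜} (hf : AnalyticAt 𝕜 f 0) :
    ∃ φ, IsMaclaurinSeries φ f := by
  obtain ⟨p, hp⟩ := hf
  refine ⟨PowerSeries.mk p.coeff, ?_⟩
  filter_upwards [hasFPowerSeriesAt_iff.1 hp] with w hw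
  simpa [mul_comm] using hw

end MaclaurinSeries

section HaagerupSeries

theorem cast_succ_mul_centralBinom_succ {R : Type*} [CommSemiring R] (n : ℕ) :
    ((n : R) + 1) * Nat.centralBinom (n + 1) = 2 * (2 * n + 1) * Nat.centralBinom n := by
  exact_mod_cast congrArg (Nat.cast : ℕ → R) (Nat.succ_mul_centralBinom_succ n)

theorem ringChoose_half_add_sub_one (n : ℕ) :
    Ring.choose ((1 / 2 : ℝ) + n - 1) n = Nat.centralBinom n / 4 ^ n := by
  have heval : (ascPochhammer ℝ n).eval (1 / 2)
      = n.factorial * (Nat.centralBinom n / 4 ^ n) := by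
    induction n with
    | zero => simp
    | succ n ih =>
      rw [ascPochhammer_succ_eval, ih, Nat.factorial_succ, pow_succ]
      push_cast
      field_simp
      linear_combination -2 * cast_succ_mul_centralBinom_succ (R := ℝ) n
  have hchoose := Ring.factorial_nsmul_multichoose_eq_ascPochhammer (1 / 2 : ℝ) n
  rw [Polynomial.ascPochhammer_smeval_eq_eval, nsmul_eq_mul, heval, Ring.multichoose_eq] at hchoose
  exact mul_left_cancel₀ (Nat.cast_ne_zero.2 n.factorial_ne_zero) hchoose

theorem hasSum_centralBinom_mul_pow {v : ℝ} (hv : |v| < 1) :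
    HasSum (fun n => (Nat.centralBinom n / 4 ^ n : ℝ) * v ^ n) (1 / √(1 - v)) := by
  have hseries := (Real.one_div_one_sub_rpow_hasFPowerSeriesOnBall_zero (1 / 2)).hasSum
    (y := v) (by simpa [enorm_eq_nnnorm, ← NNReal.coe_lt_one] using hv)
  simpa only [FormalMultilinearSeries.ofScalars_apply_eq, smul_eq_mul,
    ringChoose_half_add_sub_one, zero_add, ← Real.sqrt_eq_rpow] using hseries

theorem norm_centralBinom_mul_pow_le {v r : ℝ} (hv : |v| ≤ r) (j : ℕ) :
    ‖(Nat.centralBinom j / 4 ^ j : ℝ) * v ^ j‖ ≤ r ^ j := by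
  have hcoeff : (Nat.centralBinom j / 4 ^ j : ℝ) ≤ 1 :=
    div_le_one_of_le₀ (by exact_mod_cast Nat.centralBinom_le_four_pow j) (by positivity)
  rw [norm_mul, norm_pow, Real.norm_of_nonneg (by positivity), Real.norm_eq_abs]
  exact (mul_le_of_le_one_left (by positivity) hcoeff).trans
    (pow_le_pow_left₀ (abs_nonneg v) hv j)

theorem integral_sin_pow_even_pi_div_two (j : ℕ) :
    ∫ t in (0 : ℝ)..(π / 2), Real.sin t ^ (2 * j) = π / 2 * (Nat.centralBinom j / 4 ^ j) := by
  induction j with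
  | zero => simp
  | succ j ih =>
    rw [mul_add_one, integral_sin_pow, ih, Real.sin_zero, Real.cos_pi_div_two, pow_succ (4 : ℝ)]
    push_cast
    field_simp
    linear_combination (-2 * π) * cast_succ_mul_centralBinom_succ (R := ℝ) j

/-- The integers `C_j * binom(2 j, j)`, where `C_j` is the Catalan number. -/
def haagerupCoeff (j : ℕ) : ℕ :=
  Nat.centralBinom j * (Nat.centralBinom j / (j + 1))

theorem cast_haagerupCoeff (j : ℕ) :
    (haagerupCoeff j : ℝ) = (Nat.centralBinom j : ℝ) ^ 2 / (j + 1) := by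
  rw [haagerupCoeff, Nat.cast_mul, Nat.cast_div (Nat.succ_dvd_centralBinom j) (by positivity)]
  push_cast
  ring

theorem integral_sq_cos_mul_sin_pow (j : ℕ) :
    ∫ t in (0 : ℝ)..(π / 2), Real.cos t ^ 2 * Real.sin t ^ (2 * j)
      = π / 4 * (Nat.centralBinom j / 4 ^ j / (j + 1)) := by
  have hsplit (t : ℝ) : Real.cos t ^ 2 * Real.sin t ^ (2 * j)
      = Real.sin t ^ (2 * j) - Real.sin t ^ (2 * (j + 1)) := by
    rw [Real.cos_sq']
    ring
  simp only [hsplit]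
  rw [intervalIntegral.integral_sub (Continuous.intervalIntegrable (by fun_prop) _ _)
    (Continuous.intervalIntegrable (by fun_prop) _ _), integral_sin_pow_even_pi_div_two,
    integral_sin_pow_even_pi_div_two, pow_succ]
  field_simp
  linear_combination -cast_succ_mul_centralBinom_succ (R := ℝ) j

theorem hasSum_realHaagerupFactor {v : ℝ} (hv : |v| < 1) :
    HasSum (fun j => π / 4 * (haagerupCoeff j * (v / 16) ^ j)) (realHaagerupFactor v) := by
  set F : ℕ → ℝ → ℝ := fun j t =>
    Real.cos t ^ 2 * ((Nat.centralBinom j / 4 ^ j : ℝ) * (v * Real.sin t ^ 2) ^ j)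
  have hF (j : ℕ) : ∫ t in (0 : ℝ)..(π / 2), F j t = π / 4 * (haagerupCoeff j * (v / 16) ^ j) := by
    have hterm (t : ℝ) : F j t = (Nat.centralBinom j / 4 ^ j : ℝ) * v ^ j
        * (Real.cos t ^ 2 * Real.sin t ^ (2 * j)) := by
      simp only [F]
      ring
    simp only [hterm]
    rw [intervalIntegral.integral_const_mul, integral_sq_cos_mul_sin_pow, cast_haagerupCoeff,
      div_pow, show (16 : ℝ) ^ j = 4 ^ j * 4 ^ j by rw [← mul_pow]; norm_num]
    field
  have harg (t : ℝ) : |v * Real.sin t ^ 2| ≤ |v| := by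
    rw [abs_mul]
    exact mul_le_of_le_one_right (abs_nonneg v) (by simpa using Real.sin_sq_le_one t)
  have hbound (j : ℕ) (t : ℝ) : ‖F j t‖ ≤ |v| ^ j := by
    rw [norm_mul, Real.norm_of_nonneg (sq_nonneg (Real.cos t))]
    exact (mul_le_of_le_one_left (norm_nonneg _) (Real.cos_sq_le_one t)).trans
      (norm_centralBinom_mul_pow_le (harg t) j)
  have hlim (t : ℝ) :
      HasSum (fun j => F j t) (Real.cos t ^ 2 / √(1 - v * Real.sin t ^ 2)) := by
    simpa only [mul_one_div] using
      (hasSum_centralBinom_mul_pow ((harg t).trans_lt hv)).mul_left (Real.cos t ^ 2)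
  simp only [← hF]
  have hgeom := summable_geometric_of_lt_one (abs_nonneg v) hv
  exact intervalIntegral.hasSum_integral_of_dominated_convergence (fun j _ => |v| ^ j)
    (fun j => Continuous.aestronglyMeasurable (by fun_prop))
    (fun j => .of_forall fun t _ => hbound j t) (.of_forall fun _ _ => hgeom)
    intervalIntegrable_const (.of_forall fun t _ => hlim t)

/-- The quotient `h (4 √w) / √w` as a function of `w`. The factor `4` makes its Taylor
coefficients integer multiples of `π`. -/
noncomputable def rescaledHaagerupFactor (w : ℝ) : ℝ :=
  4 * realHaagerupFactor (16 * w)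

theorem realHaagerup_four_mul_sqrt {w : ℝ} (hw : 0 ≤ w) :
    realHaagerup (4 * √w) = √w * rescaledHaagerupFactor w := by
  rw [realHaagerup_eq_mul, mul_pow, Real.sq_sqrt hw, rescaledHaagerupFactor]
  norm_num
  ring

/-- The Taylor series of `rescaledHaagerupFactor / π`. -/
noncomputable def haagerupSeries : PowerSeries ℝ :=
  PowerSeries.mk fun j => (haagerupCoeff j : ℝ)

theorem coeff_haagerupSeries (j : ℕ) : haagerupSeries.coeff j = haagerupCoeff j :=
  PowerSeries.coeff_mk j _

theorem isMaclaurinSeries_rescaledHaagerupFactor :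
    IsMaclaurinSeries (PowerSeries.C π * haagerupSeries) rescaledHaagerupFactor := by
  have hsmall : ∀ᶠ w : ℝ in 𝓝 0, |16 * w| < 1 :=
    (Continuous.continuousAt (by fun_prop)).eventually_lt_const (by simp)
  filter_upwards [hsmall] with w hw
  refine ((hasSum_realHaagerupFactor hw).mul_left 4).congr_fun fun j => ?_
  rw [PowerSeries.coeff_C_mul, coeff_haagerupSeries, mul_div_cancel_left₀ w (by norm_num)]
  ring

end HaagerupSeries

section LowOrder

variable {b : ℕ → ℝ}

/-- The coefficient of `X ^ j` in `haagerupSeries ^ p`, by a recursion that the kernel can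
evaluate. -/
def haagerupPowCoeff : ℕ → ℕ → ℕ
  | 0, j => if j = 0 then 1 else 0
  | p + 1, j => ∑ i ∈ Finset.range (j + 1), haagerupPowCoeff p i * haagerupCoeff (j - i)

/-- The values of `b_{2k+1} * π ^ (2k+1) / 4` for `k < 10`. -/
def haagerupInvCoeff (k : ℕ) : ℤ :=
  [1, -2, 0, -4, -20, -120, -784, -5448, -39636, -298760].getD k 0

theorem coeff_haagerupSeries_pow (p j : ℕ) :
    (haagerupSeries ^ p).coeff j = haagerupPowCoeff p j := by
  induction p generalizing j with
  | zero => simp [haagerupPowCoeff, PowerSeries.coeff_one]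
  | succ p ih =>
    rw [pow_succ, PowerSeries.coeff_mul, haagerupPowCoeff,
      Finset.Nat.sum_antidiagonal_eq_sum_range_succ_mk]
    simp only [ih, coeff_haagerupSeries, Nat.cast_sum, Nat.cast_mul]

theorem haagerupPowCoeff_zero_right (p : ℕ) : haagerupPowCoeff p 0 = 1 := by
  induction p with
  | zero => rfl
  | succ p ih => simp [haagerupPowCoeff, ih, haagerupCoeff]

theorem sum_haagerupInvCoeff_mul : ∀ m < 10, ∑ k ∈ Finset.range (m + 1),
    haagerupInvCoeff k * haagerupPowCoeff (2 * k + 1) (m - k) = if m = 0 then 1 else 0 := by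
  decide +kernel

theorem haagerupInvCoeff_nonpos : ∀ k < 10, 1 ≤ k → haagerupInvCoeff k ≤ 0 := by decide

theorem eq_haagerupInvCoeff_of_system {β : ℕ → ℝ}
    (hβ : ∀ m < 10, ∑ k ∈ Finset.range (m + 1), β k * (haagerupPowCoeff (2 * k + 1) (m - k) : ℝ)
      = if m = 0 then 1 else 0) : ∀ m < 10, β m = haagerupInvCoeff m := by
  intro m
  induction m using Nat.strong_induction_on with
  | _ m ih =>
    intro hm
    have hsystem : (∑ k ∈ Finset.range (m + 1), (haagerupInvCoeff k : ℝ)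
        * (haagerupPowCoeff (2 * k + 1) (m - k) : ℝ)) = if m = 0 then 1 else 0 := by
      exact_mod_cast congrArg (Int.cast : ℤ → ℝ) (sum_haagerupInvCoeff_mul m hm)
    have hprevious : ∀ k ∈ Finset.range m, β k * (haagerupPowCoeff (2 * k + 1) (m - k) : ℝ)
        = haagerupInvCoeff k * haagerupPowCoeff (2 * k + 1) (m - k) := fun k hk => by
      rw [ih k (Finset.mem_range.1 hk) ((Finset.mem_range.1 hk).trans hm)]
    have heq := (hβ m hm).trans hsystem.symm
    rw [Finset.sum_range_succ, Finset.sum_range_succ, Finset.sum_congr rfl hprevious,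
      Nat.sub_self, haagerupPowCoeff_zero_right] at heq
    simpa using heq

namespace IsHaagerupInvExpansion

theorem eventually_hasSum_rescaledHaagerupFactor (hb : IsHaagerupInvExpansion b) :
    ∀ᶠ w in 𝓝[>] 0, HasSum (fun k => b k * (w ^ k * rescaledHaagerupFactor w ^ (2 * k + 1))) 4 := by
  have hvalue : Tendsto (fun w => √w * rescaledHaagerupFactor w) (𝓝 0) (𝓝 0) := by
    simpa using (Real.continuous_sqrt.tendsto 0).mul
      isMaclaurinSeries_rescaledHaagerupFactor.analyticAt.continuousAt.tendsto
  have hsmall : ∀ᶠ w : ℝ in 𝓝 0, 4 * √w < 1 :=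
    (Continuous.continuousAt (by fun_prop)).eventually_lt_const (by simp)
  filter_upwards [(hvalue.eventually hb).filter_mono nhdsWithin_le_nhds,
    hsmall.filter_mono nhdsWithin_le_nhds, self_mem_nhdsWithin] with w hsum hw hpos
  have hsqrt : 0 < √w := Real.sqrt_pos.2 hpos
  have hinv : realHaagerupInv (√w * rescaledHaagerupFactor w) = 4 * √w := by
    rw [← realHaagerup_four_mul_sqrt (le_of_lt hpos)]
    exact realHaagerupInv_realHaagerup ⟨by linarith, hw.le⟩
  rw [hinv] at hsum
  have hdiv := hsum.mul_right (√w)⁻¹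
  rw [mul_inv_cancel_right₀ hsqrt.ne'] at hdiv
  refine hdiv.congr_fun fun k => ?_
  rw [mul_pow, pow_succ √w, pow_mul, Real.sq_sqrt (le_of_lt hpos)]
  field

theorem exists_analyticAt_rescaled_remainder (hb : IsHaagerupInvExpansion b) (n : ℕ) :
    ∃ g : ℝ → ℝ, AnalyticAt ℝ g 0 ∧ ∀ᶠ w in 𝓝[>] 0,
      4 - ∑ k ∈ Finset.range n, b k * (w ^ k * rescaledHaagerupFactor w ^ (2 * k + 1))
        = w ^ n * (rescaledHaagerupFactor w ^ (2 * n + 1)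
          * g (w * rescaledHaagerupFactor w ^ 2)) := by
  obtain ⟨x, hx, hsummable⟩ := hb.exists_summable
  obtain ⟨g, hg, hsum⟩ :=
    exists_analyticAt_hasSum_of_summable hx (summable_shift_mul_pow hx hsummable n)
  have harg : Tendsto (fun w => w * rescaledHaagerupFactor w ^ 2) (𝓝 0) (𝓝 0) := by
    simpa using tendsto_id.mul
      (isMaclaurinSeries_rescaledHaagerupFactor.analyticAt.continuousAt.tendsto.pow 2)
  refine ⟨g, hg, ?_⟩
  filter_upwards [(harg.eventually hsum).filter_mono nhdsWithin_le_nhds,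
    hb.eventually_hasSum_rescaledHaagerupFactor] with w htail hfull
  refine ((hasSum_nat_add_iff' n).2 hfull).unique ?_
  rw [← mul_assoc]
  exact (htail.mul_left _).congr_fun fun k => by ring

theorem X_pow_dvd_sub_sum (hb : IsHaagerupInvExpansion b) (n : ℕ) :
    PowerSeries.X ^ n ∣ PowerSeries.C 4 - ∑ k ∈ Finset.range n, PowerSeries.C (b k)
      * (PowerSeries.X ^ k * (PowerSeries.C π * haagerupSeries) ^ (2 * k + 1)) := by
  obtain ⟨g, hg, hrem⟩ := hb.exists_analyticAt_rescaled_remainder n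
  have hQ := isMaclaurinSeries_rescaledHaagerupFactor
  have hC (a : ℝ) : IsMaclaurinSeries (PowerSeries.C a) fun _ => a := by
    simpa using IsMaclaurinSeries.ofPolynomial (Polynomial.C a)
  have hX (k : ℕ) : IsMaclaurinSeries (PowerSeries.X ^ k) fun w : ℝ => w ^ k := by
    simpa using IsMaclaurinSeries.ofPolynomial (Polynomial.X ^ k)
  have hanalytic : AnalyticAt ℝ (fun w => rescaledHaagerupFactor w ^ (2 * n + 1)
      * g (w * rescaledHaagerupFactor w ^ 2)) 0 :=
    (hQ.analyticAt.pow _).mul <| AnalyticAt.fun_comp (by simpa using hg)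
      (analyticAt_id.mul (hQ.analyticAt.pow 2))
  obtain ⟨ψ, hψ⟩ := exists_isMaclaurinSeries_of_analyticAt hanalytic
  refine ⟨ψ, IsMaclaurinSeries.eq_of_frequently_eq
    ((hC 4).sub (.sum _ fun k _ => (hC (b k)).mul ((hX k).mul (hQ.pow _)))) ((hX n).mul hψ) ?_⟩
  exact hrem.frequently.filter_mono (nhdsWithin_mono 0 fun w hw => ne_of_gt hw)

theorem sum_mul_haagerupPowCoeff (hb : IsHaagerupInvExpansion b) (m : ℕ) :
    ∑ k ∈ Finset.range (m + 1), b k * π ^ (2 * k + 1) * haagerupPowCoeff (2 * k + 1) (m - k)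
      = if m = 0 then 4 else 0 := by
  have hcoeff := PowerSeries.X_pow_dvd_iff.1 (hb.X_pow_dvd_sub_sum (m + 1)) m m.lt_succ_self
  rw [map_sub, map_sum, sub_eq_zero, PowerSeries.coeff_C] at hcoeff
  rw [hcoeff]
  refine Finset.sum_congr rfl fun k hk => ?_
  have hkm : k ≤ m := Nat.lt_succ_iff.1 (Finset.mem_range.1 hk)
  rw [PowerSeries.coeff_C_mul, PowerSeries.coeff_X_pow_mul', if_pos hkm, mul_pow, ← map_pow,
    PowerSeries.coeff_C_mul, coeff_haagerupSeries_pow, mul_assoc]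

theorem nonpos_of_lt_ten (hb : IsHaagerupInvExpansion b) {k : ℕ} (hk : 1 ≤ k) (hk10 : k < 10) :
    b k ≤ 0 := by
  have hsystem := hb.sum_mul_haagerupPowCoeff
  have heq : b k * π ^ (2 * k + 1) / 4 = haagerupInvCoeff k :=
    eq_haagerupInvCoeff_of_system (β := fun k => b k * π ^ (2 * k + 1) / 4) (fun m _ => by
      simp only [div_mul_eq_mul_div]
      rw [← Finset.sum_div, hsystem m]
      split_ifs <;> norm_num) k hk10
  have hnonpos : (haagerupInvCoeff k : ℝ) ≤ 0 := by
    exact_mod_cast haagerupInvCoeff_nonpos k hk10 hk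
  rw [← heq, mul_div_assoc] at hnonpos
  exact nonpos_of_mul_nonpos_left hnonpos (by positivity)

end IsHaagerupInvExpansion

end LowOrder

section Existence

theorem analyticAt_realHaagerupFactor_zero : AnalyticAt ℝ realHaagerupFactor 0 := by
  have hrescale : realHaagerupFactor = fun v => rescaledHaagerupFactor (v / 16) / 4 := by
    ext v
    rw [rescaledHaagerupFactor, mul_div_cancel₀ v (by norm_num),
      mul_div_cancel_left₀ _ four_ne_zero]
  rw [hrescale]
  exact (AnalyticAt.fun_comp (by simpa using isMaclaurinSeries_rescaledHaagerupFactor.analyticAt)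
    (analyticAt_id.div_const (c := (16 : ℝ)))).div_const

theorem analyticAt_realHaagerupFactor_sq_zero :
    AnalyticAt ℝ (fun x => realHaagerupFactor (x ^ 2)) 0 :=
  AnalyticAt.fun_comp (by simpa using analyticAt_realHaagerupFactor_zero)
    (analyticAt_id (𝕜 := ℝ).pow 2)

theorem analyticAt_realHaagerup_zero : AnalyticAt ℝ realHaagerup 0 :=
  analyticAt_id.mul analyticAt_realHaagerupFactor_sq_zero

theorem deriv_realHaagerup_zero : deriv realHaagerup 0 = π / 4 := by
  have hmul := (hasDerivAt_id (0 : ℝ)).mul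
    analyticAt_realHaagerupFactor_sq_zero.differentiableAt.hasDerivAt
  refine hmul.deriv.trans ?_
  simp [realHaagerupFactor_zero]

theorem tendsto_realHaagerupInv_zero : Tendsto realHaagerupInv (𝓝 0) (𝓝 0) := by
  have hlim : Tendsto (fun y : ℝ => 4 / π * |y|) (𝓝 0) (𝓝 0) :=
    Continuous.tendsto' (by fun_prop) 0 0 (by simp)
  refine squeeze_zero_norm' ?_ hlim
  filter_upwards [Icc_mem_nhds (show (-1 : ℝ) < 0 by norm_num) one_pos] with y hy
  have hle := pi_div_four_mul_abs_le_abs_realHaagerup (realHaagerupInv_mem_Icc hy)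
  rw [realHaagerup_realHaagerupInv hy] at hle
  rw [Real.norm_eq_abs, div_mul_eq_mul_div, le_div_iff₀ Real.pi_pos]
  linarith

theorem analyticAt_realHaagerupInv_zero : AnalyticAt ℝ realHaagerupInv 0 := by
  have h := analyticAt_realHaagerup_zero
  have hderiv : deriv realHaagerup 0 ≠ 0 := by
    rw [deriv_realHaagerup_zero]
    positivity
  have hinv := h.analyticAt_localInverse hderiv
  rw [realHaagerup_zero] at hinv
  refine hinv.congr ?_
  filter_upwards [tendsto_realHaagerupInv_zero.eventually
    (h.hasStrictDerivAt.eventually_left_inverse hderiv),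
    Icc_mem_nhds (show (-1 : ℝ) < 0 by norm_num) one_pos] with y hleft hy
  rwa [realHaagerup_realHaagerupInv hy] at hleft

theorem hasSum_odd_of_hasSum_neg {𝕜 : Type*} [NormedField 𝕜] [CharZero 𝕜] {c : ℕ → 𝕜} {y s : 𝕜}
    (hpos : HasSum (fun n => c n * y ^ n) s) (hneg : HasSum (fun n => c n * (-y) ^ n) (-s)) :
    HasSum (fun k => c (2 * k + 1) * y ^ (2 * k + 1)) s := by
  have hdiff := (hpos.sub hneg).div_const 2
  rw [sub_neg_eq_add, add_self_div_two] at hdiff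
  have hinj : Function.Injective fun k : ℕ => 2 * k + 1 := fun a c h => by
    simpa using h
  rw [← hinj.hasSum_iff] at hdiff
  · refine hdiff.congr_fun fun k => ?_
    rw [Function.comp_apply, Odd.neg_pow ⟨k, rfl⟩]
    ring
  · intro n hn
    have heven : Even n := Nat.not_odd_iff_even.1 fun ⟨k, hk⟩ => hn ⟨k, hk.symm⟩
    rw [heven.neg_pow, sub_self, zero_div]

theorem exists_isHaagerupInvExpansion : ∃ b : ℕ → ℝ, IsHaagerupInvExpansion b := by
  obtain ⟨φ, hφ⟩ := exists_isMaclaurinSeries_of_analyticAt analyticAt_realHaagerupInv_zero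
  refine ⟨fun k => φ.coeff (2 * k + 1), ?_⟩
  have hneg : Tendsto (fun y : ℝ => -y) (𝓝 0) (𝓝 0) := continuous_neg.tendsto' 0 0 neg_zero
  filter_upwards [hφ, hneg.eventually hφ,
    Icc_mem_nhds (show (-1 : ℝ) < 0 by norm_num) one_pos] with y hpos hsum hy
  rw [realHaagerupInv_neg hy] at hsum
  exact hasSum_odd_of_hasSum_neg hpos hsum

end Existence

theorem mainTheorem2 :
    BijOn realHaagerup (Icc (-1) 1) (Icc (-1) 1) ∧
    (∃ b : ℕ → ℝ, IsHaagerupInvExpansion b) ∧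
    ∀ b : ℕ → ℝ, IsHaagerupInvExpansion b → ∀ k : ℕ, 1 ≤ k → b k ≤ 0 := by
  refine ⟨bijOn_realHaagerup, exists_isHaagerupInvExpansion, fun b hb k hk => ?_⟩
  rcases lt_or_ge k 10 with hk10 | hk10
  · exact hb.nonpos_of_lt_ten hk hk10
  · exact hb.nonpos_of_ten_le hk10
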